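/- Let $d\ge 2$, let $m_1,\dots,m_N>0$, and let $\mathcal X=\{x=(x_1,\dots,x_N)\in(\mathbb R^d)^N:\sum_i m_ix_i=0\}$ with $\langle x,y\rangle_{\mathcal M}=\sum_i m_i\langle x_i,y_i\rangle$ and $\|x\|_{\mathcal M}^2=\langle x,x\rangle_{\mathcal M}$. For a set $K$ of bodies let $U_K(x)=\sum_{i<j,\ i,j\in K}\frac{m_im_j}{|x_i-x_j|}\in[0,\infty]$ (equal to $\infty$ at collisions in $K$), and let $U$ be the potential of all bodies. A normalized minimal central configuration of $K$ is a minimizer of $U_K$ among the $b=(b_i)_{i\in K}$ with $\sum_{i\in K}m_ib_i=0$ and $\sum_{i\in K}m_i|b_i|^2=1$; for it put $\beta_K=\sqrt[3]{\tfrac92U_K(b)}$. Let $r_0(t)=at+ct^{2/3}$, $t\ge1$, be a reference path of one of the following three kinds. (Hyperbolic) $a\in\mathcal X$ has no collisions and $c=0$. (Parabolic) $a=0$ and $c=\beta b$, where $b$ is a normalized minimal central configuration of all bodies and $\beta=\sqrt[3]{\tfrac92U(b)}$. (Hyperbolic-parabolic) $a\in\mathcal X$ is nonzero and has collisions. Call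 the classes of the relation $a_i=a_j$ clusters. On every cluster $K$ with at least two bodies $c=\beta_Kb^K$ for some normalized minimal central configuration $b^K$ of $K$, and $c_i=0$ if $\{i\}$ is a cluster. Let $\tilde x_0\in\mathcal X$, and let $\mathcal D_0^{1,2}(1,+\infty)$ be the space of locally absolutely continuous $\varphi:[1,+\infty)\to\mathcal X$ with $\varphi(1)=0$ and $\int_1^\infty\|\dot\varphi\|_{\mathcal M}^2\,dt<\infty$. For $\varphi\in\mathcal D_0^{1,2}(1,+\infty)$ consider the renormalized action $$\mathcal A(\varphi)=\int_1^{+\infty}\tfrac12\|\dot\varphi(t)\|_{\mathcal M}^2+U(\varphi(t)+r_0(t)+\tilde x_0)-P(t)-\langle\ddot r_0(t),\varphi(t)\rangle_{\mathcal M}\,dt\in(-\infty,+\infty],$$ which is $+\infty$ when the integrand is not integrable or $U(\varphi+r_0+\tilde x_0)=\infty$ on a set of times of positive measure. Here $P(t)=U(r_0(t))$, provided that $r_0(t)$ has no collision for $t\ge1$; without this proviso one may also take $P(t)=\sum_{i<j,\ a_i=a_j}\frac{m_im_j}{|c_i-c_j|t^{2/3}}+\sum_{i<j,\ a_i\ne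 a_j}\frac{m_im_j}{|a_i-a_j|t}$. Suppose that $\varphi$ minimizes $\mathcal A$ on $\mathcal D_0^{1,2}(1,+\infty)$, with a finite minimum, and let $x(t)=r_0(t)+\varphi(t)+\tilde x_0$ for $t\ge1$ (in particular, $x$ may be any expansive motion of the $N$-body problem of this form). Put $h=\tfrac12\|a\|_{\mathcal M}^2$. Then: (i) $h$ is the energy level of $x$: $U(x(t))<\infty$ and $\tfrac12\|\dot x(t)\|_{\mathcal M}^2-U(x(t))=h$ for almost every $t>1$. (ii) $x$ is a free-time minimizer of the Lagrangian action at energy $h$: for every $1\le a_1<b_1$ the action of $x$ on $[a_1,b_1]$ is finite, and for every $1\le a_2<b_2$ and every absolutely continuous $\sigma:[a_2,b_2]\to\mathcal X$ with $\sigma(a_2)=x(a_1)$ and $\sigma(b_2)=x(b_1)$, $$\int_{a_1}^{b_1}\tfrac12\|\dot x\|_{\mathcal M}^2+U(x)\,dt+h(b_1-a_1)\le\int_{a_2}^{b_2}\tfrac12\|\dot\sigma\|_{\mathcal M}^2+U(\sigma)\,dt+h(b_2-a_2).$$ (iii) $x$ is a geodesic ray from $x(1)=r_0(1)+\tilde x_0$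 of the Jacobi-Maupertuis metric $(U+h)\,ds_{\mathcal M}^2$ of level $h$: its restriction to any compact interval $[a_1,b_1]\subset[1,+\infty)$ is a minimizing geodesic, that is, $\int_{a_1}^{b_1}\sqrt{U(x)+h}\,\|\dot x\|_{\mathcal M}\,dt$ is finite and least among the lengths of all absolutely continuous curves in $\mathcal X$ with the same ends. -/

import Mathlib

open MeasureTheory Set
open scoped ENNReal NNReal

noncomputable section

namespace NBody

/-- Positions of `N` bodies in Euclidean `ℝ^d`. -/
abbrev Config (N d : ℕ) : Type := Fin N → EuclideanSpace ℝ (Fin d)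

variable {N d : ℕ}

/-- The configuration space `𝒳`: the centre of mass is at the origin. -/
def configSpace (m : Fin N → ℝ) : Submodule ℝ (Config N d) where
  carrier := {x | ∑ i, m i • x i = 0}
  add_mem' := by
    intro x y hx hy
    simp only [Set.mem_ofPred_eq] at hx hy ⊢
    simp [smul_add, Finset.sum_add_distrib, hx, hy]
  zero_mem' := by simp
  smul_mem' := by
    intro r x hx
    simp only [Set.mem_ofPred_eq] at hx ⊢
    simp only [Pi.smul_apply, smul_comm (m _) r, ← Finset.smul_sum, hx, smul_zero]

/-- The mass scalar product `⟨x, y⟩_𝓜 = ∑ mᵢ ⟨xᵢ, yᵢ⟩`. -/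
def massInner (m : Fin N → ℝ) (x y : Config N d) : ℝ := ∑ i, m i * inner ℝ (x i) (y i)

/-- The squared mass norm `‖x‖²_𝓜`. -/
def massNormSq (m : Fin N → ℝ) (x : Config N d) : ℝ := massInner m x x

/-- No two bodies are at the same place. -/
def CollisionFree (x : Config N d) : Prop := ∀ i j, i ≠ j → x i ≠ x j

/-- The Newtonian potential of the bodies in `K`; it is `∞` when two of them collide
(for positive masses). -/
def clusterPotential (m : Fin N → ℝ) (K : Finset (Fin N)) (x : Config N d) : ℝ≥0∞ :=
  ∑ i ∈ K, ∑ j ∈ K with i < j, ENNReal.ofReal (m i * m j) / ENNReal.ofReal ‖x i - x j‖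

/-- The Newtonian potential `U : 𝒳 → (0, ∞]` of all bodies. -/
def potential (m : Fin N → ℝ) (x : Config N d) : ℝ≥0∞ := clusterPotential m Finset.univ x

/-! ### Curves, action, free-time minimizers, Jacobi-Maupertuis metric -/

/-- `γ` is an absolutely continuous curve `[a, b] → 𝒳`. -/
def IsCurve (m : Fin N → ℝ) (γ : ℝ → Config N d) (a b : ℝ) : Prop :=
  AbsolutelyContinuousOnInterval γ a b ∧ ∀ t ∈ Icc a b, γ t ∈ configSpace m

/-- The Lagrangian action `∫_a^b ½‖γ'‖²_𝓜 + U(γ) dt ∈ [0, ∞]`. -/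
def lagrangianAction (m : Fin N → ℝ) (γ : ℝ → Config N d) (a b : ℝ) : ℝ≥0∞ :=
  ∫⁻ t in Icc a b, (ENNReal.ofReal (massNormSq m (deriv γ t) / 2) + potential m (γ t))

/-- `γ : I → 𝒳` is a free-time minimizer of the Lagrangian action at energy `h ≥ 0`: on each
compact interval it has finite action, and its action plus `h` times the elapsed time does not
exceed that of any curve with the same ends, whatever time this curve takes. -/
def IsFreeTimeMinimizer (m : Fin N → ℝ) (h : ℝ≥0) (I : Set ℝ) (γ : ℝ → Config N d) : Prop :=
  ∀ a b : ℝ, a < b → Icc a b ⊆ I →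
    IsCurve m γ a b ∧ lagrangianAction m γ a b ≠ ∞ ∧
    ∀ (a' b' : ℝ) (σ : ℝ → Config N d), a' < b' → Icc a' b' ⊆ I → IsCurve m σ a' b' →
      σ a' = γ a → σ b' = γ b →
      lagrangianAction m γ a b + ENNReal.ofReal (h * (b - a)) ≤
        lagrangianAction m σ a' b' + ENNReal.ofReal (h * (b' - a'))

/-- The length `∫_a^b (U(γ) + h)^{1/2} ‖γ'‖_𝓜 dt` of a curve for the Jacobi-Maupertuis metric
`(U + h) ds²_𝓜` of level `h ≥ 0`. -/
def jacobiLength (m : Fin N → ℝ) (h : ℝ≥0) (γ : ℝ → Config N d) (a b : ℝ) : ℝ≥0∞ :=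
  ∫⁻ t in Icc a b, (potential m (γ t) + (h : ℝ≥0∞)) ^ (1 / 2 : ℝ) *
    ENNReal.ofReal (Real.sqrt (massNormSq m (deriv γ t)))

/-- The restriction of `γ` to `[a, b]` is a minimizing geodesic of the Jacobi-Maupertuis metric:
its length is finite and least among all curves in `𝒳` with the same ends. -/
def IsMinimizingGeodesic (m : Fin N → ℝ) (h : ℝ≥0) (γ : ℝ → Config N d) (a b : ℝ) : Prop :=
  IsCurve m γ a b ∧ jacobiLength m h γ a b ≠ ∞ ∧
    ∀ (a' b' : ℝ) (σ : ℝ → Config N d), a' < b' → IsCurve m σ a' b' →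
      σ a' = γ a → σ b' = γ b → jacobiLength m h γ a b ≤ jacobiLength m h σ a' b'

/-- `γ : [1, ∞) → 𝒳` is a geodesic ray from `p` of the Jacobi-Maupertuis metric of level `h`. -/
def IsGeodesicRay (m : Fin N → ℝ) (h : ℝ≥0) (p : Config N d) (γ : ℝ → Config N d) : Prop :=
  γ 1 = p ∧ ∀ a b : ℝ, 1 ≤ a → a < b → IsMinimizingGeodesic m h γ a b

/-! ### The three classes of reference paths -/

/-- The reference path `r₀(t) = a t + c t^{2/3}`, where `c` stands for `βb`. -/
def refPath (a c : Config N d) (t : ℝ) : Config N d := t • a + t ^ (2 / 3 : ℝ) • c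

/-- `b`, restricted to the bodies in `K`, is a normalized minimal central configuration of the
cluster `K`: it minimizes the potential of the cluster on the inertia ellipsoid of the cluster. -/
def IsMinimalCentral (m : Fin N → ℝ) (K : Finset (Fin N)) (b : Config N d) : Prop :=
  (∑ i ∈ K, m i • b i = 0 ∧ ∑ i ∈ K, m i * ‖b i‖ ^ 2 = 1) ∧
  ∀ y : Config N d, ∑ i ∈ K, m i • y i = 0 → ∑ i ∈ K, m i * ‖y i‖ ^ 2 = 1 →
    clusterPotential m K b ≤ clusterPotential m K y

/-- The factor `β_K = (9/2 · U_K(b))^{1/3}`. -/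
def betaFactor (m : Fin N → ℝ) (K : Finset (Fin N)) (b : Config N d) : ℝ :=
  (9 / 2 * (clusterPotential m K b).toReal) ^ (1 / 3 : ℝ)

open Classical in
/-- The cluster of body `i` in the natural partition of `a`: `i ∼ j ↔ aᵢ = aⱼ`. -/
def cluster (a : Config N d) (i : Fin N) : Finset (Fin N) := {j | a j = a i}

/-- Hyperbolic setting: `r₀(t) = a t` with `a ∈ 𝒳` without collisions. -/
def HyperbolicSetting (m : Fin N → ℝ) (a c : Config N d) : Prop :=
  a ∈ configSpace m ∧ CollisionFree a ∧ c = 0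

/-- Parabolic setting: `r₀(t) = β b t^{2/3}` with `b` a normalized minimal central configuration
and `β = (9/2 · U(b))^{1/3}`. -/
def ParabolicSetting (m : Fin N → ℝ) (a c : Config N d) : Prop :=
  a = 0 ∧ ∃ b : Config N d, IsMinimalCentral m Finset.univ b ∧
    c = betaFactor m Finset.univ b • b

/-- Hyperbolic-parabolic setting: `r₀(t) = a t + β b t^{2/3}`, where `a ∈ 𝒳` is nonzero and has
collisions and `βb` is put together from the blocks `β_K b^K`, with `b^K` a normalized minimal
central configuration of the cluster `K`; a cluster with a single body contributes the block `0`. -/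
def HyperbolicParabolicSetting (m : Fin N → ℝ) (a c : Config N d) : Prop :=
  a ∈ configSpace m ∧ a ≠ 0 ∧ ¬ CollisionFree a ∧
  ∃ b : Config N d, ∀ i : Fin N,
    ((cluster a i).card = 1 → c i = 0) ∧
    (2 ≤ (cluster a i).card →
      IsMinimalCentral m (cluster a i) b ∧ c i = betaFactor m (cluster a i) b • b i)

/-! ### The renormalized action -/

/-- The space `𝒟₀^{1,2}([1, ∞), 𝒳)`: locally absolutely continuous `φ` with `φ(1) = 0` and
`∫₁^∞ ‖φ'‖²_𝓜 dt < ∞`. -/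
def IsD012 (m : Fin N → ℝ) (φ : ℝ → Config N d) : Prop :=
  (∀ T : ℝ, 1 < T → IsCurve m φ 1 T) ∧ φ 1 = 0 ∧
    ∫⁻ t in Ioi (1 : ℝ), ENNReal.ofReal (massNormSq m (deriv φ t)) < ∞

open Classical in
/-- The sum of the pair potentials along the leading order of `r₀`: pairs in one cluster
contribute `mᵢmⱼ / |cᵢⱼ t^{2/3}|`, the others `mᵢmⱼ / |aᵢⱼ t|`. It is finite for all `t ≥ 1`, even
where bodies of different clusters collide along `r₀`. -/
def clusteredReference (m : Fin N → ℝ) (a c : Config N d) (t : ℝ) : ℝ :=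
  ∑ i, ∑ j with i < j,
    m i * m j / (if a i = a j then ‖c i - c j‖ * t ^ (2 / 3 : ℝ) else ‖a i - a j‖ * t)

/-- The terms that may be subtracted from `U` to renormalize the action: `U(r₀(t))`, provided that
`r₀` has no collisions on `[1, ∞)`, or the clustered version of it. -/
def IsReferencePotential (m : Fin N → ℝ) (a c : Config N d) (P : ℝ → ℝ) : Prop :=
  ((∀ t : ℝ, 1 ≤ t → CollisionFree (refPath a c t)) ∧
    P = fun t => (potential m (refPath a c t)).toReal) ∨
  P = clusteredReference m a c

/-- The renormalized Lagrangian
`½‖φ'‖²_𝓜 + U(φ + r₀ + x₀) - P - ⟨𝓜 r₀'', φ⟩` at time `t`, where `U` is finite. -/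
def renormLagrangian (m : Fin N → ℝ) (a c x₀ : Config N d) (P : ℝ → ℝ) (φ : ℝ → Config N d)
    (t : ℝ) : ℝ :=
  massNormSq m (deriv φ t) / 2 + (potential m (φ t + refPath a c t + x₀)).toReal - P t
    - massInner m (deriv (deriv (refPath a c)) t) (φ t)

/-- The renormalized action of `φ` is finite. -/
def HasFiniteRenormAction (m : Fin N → ℝ) (a c x₀ : Config N d) (P : ℝ → ℝ)
    (φ : ℝ → Config N d) : Prop :=
  (∀ᵐ t ∂(volume.restrict (Ioi (1 : ℝ))), potential m (φ t + refPath a c t + x₀) ≠ ∞) ∧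
    IntegrableOn (renormLagrangian m a c x₀ P φ) (Ioi (1 : ℝ))

open Classical in
/-- The renormalized action `𝒜^{ren}(φ) ∈ (-∞, ∞]`. -/
def renormAction (m : Fin N → ℝ) (a c x₀ : Config N d) (P : ℝ → ℝ) (φ : ℝ → Config N d) : EReal :=
  if HasFiniteRenormAction m a c x₀ P φ then
    ((∫ t in Ioi (1 : ℝ), renormLagrangian m a c x₀ P φ t : ℝ) : EReal)
  else ⊤

/-- `φ` minimizes the renormalized action on `𝒟₀^{1,2}`, and the minimum is finite. -/
def MinimizesRenormAction (m : Fin N → ℝ) (a c x₀ : Config N d) (P : ℝ → ℝ)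
    (φ : ℝ → Config N d) : Prop :=
  IsD012 m φ ∧ renormAction m a c x₀ P φ ≠ ⊤ ∧
    ∀ ψ : ℝ → Config N d, IsD012 m ψ → renormAction m a c x₀ P φ ≤ renormAction m a c x₀ P ψ

end NBody

end

/-! The renormalized action sees only a total derivative and a reference term besides the
Lagrangian: integrating ⟨r₀'', φ⟩ by parts, the renormalized Lagrangian equals ½‖x'‖² + U(x) −
(½‖r₀'‖² + P) − (d/dt)⟨r₀', φ⟩ (`ae_renormLagrangian_eq`). So minimality for a fixed time
parametrization can be turned into free-time minimality by letting the competitor arrive late or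
early and delaying all the rest of the motion.

Let σ join x(s) to x(u) in time u' − s', and put T = (u' − s') − (u − s). Replace x on [s, u] by σ
and run x with delay T afterwards. The new perturbation is, for late t, ψ(t) = φ(t − T) + r₀(t − T)
− r₀(t). It again lies in 𝒟₀^{1,2} with finite renormalized action, since U along ψ at t is U along
φ at t − T and everything else changes integrably under a shift (`IsTame`,
`IsD012.integrableOn_renormLagrangian_shift`). Now compare ψ on [1, R + T] with φ on [1, R]. The
Lagrangian actions differ by D, the action of σ minus that of x on [s, u]. The reference terms
contribute minus their integral over [R, R + T], which tends to −T‖a‖²/2 = −hT. The boundary terms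
tend to ⟨a, Ta⟩ = 2hT. Minimality of φ hence gives D + hT ≥ 0, which is the claim
(`tendsto_renormAction_difference`, `isFreeTimeMinimizer_trajectory`).

The rest is Maupertuis' principle. By the inequality of the means, √2 · √(U + h) ‖σ'‖ ≤ ½‖σ'‖² + U +
h, with equality at finite potential exactly at energy h. A curve of finite Jacobi length is either
a loop or can be rerun at energy h (`exists_action_le_jacobiLength`), so √2 times its length bounds
the minimal action plus h times the elapsed time. This makes x a minimizing geodesic, and with x as
its own competitor it forces equality almost everywhere, that is, the energy relation. -/

open Filter Topology

/-! ### Absolutely continuous functions -/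

namespace AbsolutelyContinuousOnInterval

/-- A function whose increments are bounded by an integral is absolutely continuous. -/
theorem of_edist_le_lintegral {X : Type*} [PseudoMetricSpace X] {f : ℝ → X} {a b : ℝ}
    (hab : a ≤ b) {g : ℝ → ℝ≥0∞} (hg : ∫⁻ t in Ioc a b, g t ≠ ∞)
    (h : ∀ s ∈ Icc a b, ∀ t ∈ Icc a b, s ≤ t → edist (f s) (f t) ≤ ∫⁻ r in Ioc s t, g r) :
    AbsolutelyContinuousOnInterval f a b := by
  let s := fun E : ℕ × (ℕ → ℝ × ℝ) ↦ ⋃ i ∈ Finset.range E.1, uIoc (E.2 i).1 (E.2 i).2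
  rw [← uIoc_of_le hab] at hg
  -- Absolute continuity of the integral: the total length of the intervals tends to 0, hence so
  -- does the integral of `g` over their union.
  have key : Tendsto (fun i ↦ ∫⁻ x in s i, g x ∂volume.restrict (uIoc a b))
      (totalLengthFilter ⊓ 𝓟 (disjWithin a b)) (𝓝 0) :=
    tendsto_setLIntegral_zero hg
      (tendsto_volume_restrict_totalLengthFilter_disjWithin_nhds_zero _ _)
  have key' := ENNReal.toReal_zero ▸ (ENNReal.continuousAt_toReal (by simp)).tendsto.comp key
  refine squeeze_zero' ?_ ?_ key'
  · filter_upwards with E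
    exact Finset.sum_nonneg fun _ _ ↦ dist_nonneg
  have hev : ∀ᶠ (E : ℕ × (ℕ → ℝ × ℝ)) in totalLengthFilter ⊓ 𝓟 (disjWithin a b),
      E ∈ disjWithin a b := eventually_inf_principal.mpr (by simp)
  filter_upwards [hev] with ⟨n, I⟩ hnI
  obtain ⟨hnI1, hnI2⟩ := mem_ofPred_eq ▸ hnI
  have hfin : ∫⁻ x in s (n, I), g x ∂volume.restrict (uIoc a b) ≠ ∞ :=
    ((setLIntegral_le_lintegral _ _).trans_lt hg.lt_top).ne
  rw [Function.comp_apply]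
  refine (ENNReal.ofReal_le_iff_le_toReal hfin).1 ?_
  rw [ENNReal.ofReal_sum_of_nonneg fun _ _ ↦ dist_nonneg]
  simp only [s]
  rw [lintegral_biUnion_finset hnI2 (fun _ _ ↦ measurableSet_uIoc)]
  refine Finset.sum_le_sum fun i hi ↦ ?_
  rw [Measure.restrict_restrict_of_subset
    (uIoc_subset_of_mem_disjWithin hnI (Finset.mem_range.mp hi)), ← edist_dist]
  obtain ⟨h1, h2⟩ := hnI1 i hi
  rw [uIcc_of_le hab] at h1 h2
  rcases le_total (I i).1 (I i).2 with hle | hle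
  · rw [uIoc_of_le hle]
    exact h _ h1 _ h2 hle
  · rw [uIoc_of_ge hle, edist_comm]
    exact h _ h2 _ h1 hle

variable {V : Type*} [NormedAddCommGroup V] [NormedSpace ℝ V]

/-- Composition with a continuous linear map. -/
theorem clm_comp {W : Type*} [NormedAddCommGroup W] [NormedSpace ℝ W] {f : ℝ → V} {a b : ℝ}
    (hf : AbsolutelyContinuousOnInterval f a b) (L : V →L[ℝ] W) :
    AbsolutelyContinuousOnInterval (fun t ↦ L (f t)) a b := by
  refine squeeze_zero (fun _ ↦ Finset.sum_nonneg fun _ _ ↦ dist_nonneg) (fun E ↦ ?_)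
    (by simpa using Tendsto.const_mul ‖L‖ hf)
  rw [Finset.mul_sum]
  refine Finset.sum_le_sum fun i _ ↦ ?_
  rw [dist_eq_norm, dist_eq_norm, ← map_sub]
  exact L.le_opNorm _

variable [FiniteDimensional ℝ V]

theorem ae_differentiableAt' {f : ℝ → V} {a b : ℝ} (hf : AbsolutelyContinuousOnInterval f a b) :
    ∀ᵐ t, t ∈ uIcc a b → DifferentiableAt ℝ f t :=
  hf.boundedVariationOn.ae_differentiableAt_of_mem_uIcc

theorem ae_deriv_clm_comp {f : ℝ → V} {a b : ℝ} (hf : AbsolutelyContinuousOnInterval f a b)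
    (L : V →L[ℝ] ℝ) : ∀ᵐ t, t ∈ uIcc a b → deriv (fun s ↦ L (f s)) t = L (deriv f t) := by
  filter_upwards [hf.ae_differentiableAt'] with t ht hmem
  exact (L.hasFDerivAt.comp_hasDerivAt t (ht hmem).hasDerivAt).deriv

/-- Expand the derivative in a finite basis: every coordinate is a real absolutely continuous
function, whose derivative is integrable. -/
theorem lintegral_enorm_deriv_ne_top {f : ℝ → V} {a b : ℝ} (hab : a ≤ b)
    (hf : AbsolutelyContinuousOnInterval f a b) : ∫⁻ t in Ioc a b, ‖deriv f t‖ₑ ≠ ∞ := by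
  let B := Module.finBasis ℝ V
  let L := fun i ↦ LinearMap.toContinuousLinearMap (B.coord i)
  have hle : ∫⁻ t in Ioc a b, ‖deriv f t‖ₑ ≤
      ∫⁻ t in Ioc a b, ∑ i, ‖deriv (fun s ↦ L i (f s)) t‖ₑ * ‖B i‖ₑ := by
    refine lintegral_mono_ae ?_
    have hall : ∀ᵐ t, ∀ i, t ∈ uIcc a b → deriv (fun s ↦ L i (f s)) t = L i (deriv f t) :=
      ae_all_iff.2 fun i ↦ hf.ae_deriv_clm_comp (L i)
    refine (ae_restrict_iff' measurableSet_Ioc).2 ?_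
    filter_upwards [hall] with t ht hmem
    rw [uIcc_of_le hab] at ht
    simp only [fun i ↦ ht i (Ioc_subset_Icc_self hmem)]
    conv_lhs => rw [← B.sum_repr (deriv f t)]
    refine (enorm_sum_le _ _).trans (Finset.sum_le_sum fun i _ ↦ ?_)
    rw [enorm_smul]
    rfl
  refine (hle.trans_lt ?_).ne
  rw [lintegral_finsetSum]
  · refine ENNReal.sum_lt_top.2 fun i _ ↦ ?_
    rw [lintegral_mul_const _ (measurable_deriv _).enorm]
    refine ENNReal.mul_lt_top ?_ enorm_lt_top
    have := (hf.clm_comp (L i)).intervalIntegrable_deriv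
    rw [intervalIntegrable_iff, uIoc_of_le hab] at this
    exact this.2
  · exact fun i _ ↦ (measurable_deriv _).enorm.mul_const _

/-- A functional norming `f t - f s` reduces this to the fundamental theorem of calculus for real
functions. Together with `of_edist_le_lintegral` it characterizes absolute continuity by integral
bounds, the form in which curves are glued, shifted and reparametrized. -/
theorem edist_le_lintegral {f : ℝ → V} {a b : ℝ}
    (hf : AbsolutelyContinuousOnInterval f a b) {s t : ℝ} (hs : s ∈ Icc a b) (ht : t ∈ Icc a b)
    (hst : s ≤ t) : edist (f s) (f t) ≤ ∫⁻ r in Ioc s t, ‖deriv f r‖ₑ := by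
  have hsub : uIcc s t ⊆ uIcc a b := by
    rw [uIcc_of_le hst, uIcc_of_le (hs.1.trans hs.2)]
    exact Icc_subset_Icc hs.1 ht.2
  have hf' := hf.mono hsub
  obtain ⟨L, hL, hLv⟩ := exists_dual_vector'' ℝ (f t - f s)
  have hint := (hf'.clm_comp L).integral_deriv_eq_sub
  rw [edist_comm, edist_eq_enorm_sub]
  have h1 : ‖f t - f s‖ₑ = ‖∫ r in s..t, deriv (fun u ↦ L (f u)) r‖ₑ := by
    rw [hint, ← map_sub, hLv]
    simp
  rw [h1, intervalIntegral.integral_of_le hst]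
  refine (enorm_integral_le_lintegral_enorm _).trans (lintegral_mono_ae ?_)
  refine (ae_restrict_iff' measurableSet_Ioc).2 ?_
  filter_upwards [hf'.ae_deriv_clm_comp L] with r hr hmem
  rw [hr (by rw [uIcc_of_le hst]; exact Ioc_subset_Icc_self hmem)]
  have := L.le_opNorm (deriv f r)
  rw [← ofReal_norm, ← ofReal_norm]
  refine ENNReal.ofReal_le_ofReal (this.trans ?_)
  exact mul_le_of_le_one_left (norm_nonneg _) hL

theorem congr_eqOn {X : Type*} [PseudoMetricSpace X] {f g : ℝ → X} {a b : ℝ}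
    (hf : AbsolutelyContinuousOnInterval f a b) (h : EqOn f g (uIcc a b)) :
    AbsolutelyContinuousOnInterval g a b := by
  rw [absolutelyContinuousOnInterval_iff] at hf ⊢
  intro ε hε
  obtain ⟨δ, hδ, H⟩ := hf ε hε
  refine ⟨δ, hδ, fun E hE hlt ↦ ?_⟩
  convert! H E hE hlt using 1
  refine Finset.sum_congr rfl fun i hi ↦ ?_
  rw [h (hE.1 i hi).1, h (hE.1 i hi).2]

/-- Two absolutely continuous pieces on adjacent intervals. -/
theorem union {f : ℝ → V} {a b c : ℝ} (hab : a ≤ b) (hbc : b ≤ c)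
    (hf : AbsolutelyContinuousOnInterval f a b) (hg : AbsolutelyContinuousOnInterval f b c) :
    AbsolutelyContinuousOnInterval f a c := by
  refine of_edist_le_lintegral (hab.trans hbc) (g := fun t ↦ ‖deriv f t‖ₑ) ?_ ?_
  · rw [← Ioc_union_Ioc_eq_Ioc hab hbc]
    refine ((lintegral_union_le _ _ _).trans_lt (ENNReal.add_lt_top.2
      ⟨(hf.lintegral_enorm_deriv_ne_top hab).lt_top,
        (hg.lintegral_enorm_deriv_ne_top hbc).lt_top⟩)).ne
  · intro s hs t ht hst
    rcases le_total t b with htb | htb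
    · exact hf.edist_le_lintegral ⟨hs.1, hst.trans htb⟩ ⟨ht.1, htb⟩ hst
    rcases le_total b s with hsb | hsb
    · exact hg.edist_le_lintegral ⟨hsb, hs.2⟩ ⟨htb, ht.2⟩ hst
    rw [← Ioc_union_Ioc_eq_Ioc hsb htb,
      lintegral_union measurableSet_Ioc (Ioc_disjoint_Ioc_of_le le_rfl)]
    exact (edist_triangle _ (f b) _).trans (add_le_add
      (hf.edist_le_lintegral ⟨hs.1, hsb⟩ ⟨hab, le_rfl⟩ hsb)
      (hg.edist_le_lintegral ⟨le_rfl, hbc⟩ ⟨htb, ht.2⟩ htb))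

/-- Time shifts of absolutely continuous functions. -/
theorem comp_sub_const {f : ℝ → V} {a b : ℝ} (hab : a ≤ b)
    (hf : AbsolutelyContinuousOnInterval f a b) (T : ℝ) :
    AbsolutelyContinuousOnInterval (fun t ↦ f (t - T)) (a + T) (b + T) := by
  have hpre : ∀ s t, ∫⁻ r in Ioc s t, ‖deriv f (r - T)‖ₑ =
      ∫⁻ r in Ioc (s - T) (t - T), ‖deriv f r‖ₑ := fun s t ↦ by
    simpa using (measurePreserving_sub_right volume T).setLIntegral_comp_preimage_emb
      (MeasurableEquiv.subRight T).measurableEmbedding (fun r ↦ ‖deriv f r‖ₑ)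
      (Ioc (s - T) (t - T))
  refine of_edist_le_lintegral (by linarith) (g := fun t ↦ ‖deriv f (t - T)‖ₑ) ?_ ?_
  · rw [hpre]
    simpa using hf.lintegral_enorm_deriv_ne_top hab
  · intro s hs t ht hst
    rw [hpre]
    exact hf.edist_le_lintegral ⟨by linarith [hs.1], by linarith [hs.2]⟩
      ⟨by linarith [ht.1], by linarith [ht.2]⟩ (by linarith)

end AbsolutelyContinuousOnInterval

/-! ### Reparametrization by a monotone clock -/

section Clock

variable {a b : ℝ} {l : ℝ → ℝ}

theorem monotone_clock (h0 : ∀ t, 0 ≤ l t) (hl : Integrable l) :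
    Monotone fun t ↦ ∫ r in a..t, l r := by
  intro s t hst
  have := intervalIntegral.integral_add_adjacent_intervals (hl.intervalIntegrable (a := a) (b := s))
    (hl.intervalIntegrable (a := s) (b := t))
  have h2 : 0 ≤ ∫ r in s..t, l r := intervalIntegral.integral_nonneg hst fun r _ ↦ h0 r
  simp only
  linarith

theorem continuous_clock (hl : Integrable l) : Continuous fun t ↦ ∫ r in a..t, l r :=
  intervalIntegral.continuous_primitive (fun _ _ ↦ hl.intervalIntegrable) a

theorem ofReal_clock (h0 : ∀ t, 0 ≤ l t) (hl : Integrable l) {t : ℝ} (hat : a ≤ t) :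
    ∫⁻ r in Icc a t, ENNReal.ofReal (l r) = ENNReal.ofReal (∫ r in a..t, l r) := by
  rw [intervalIntegral.integral_of_le hat, ← integral_Icc_eq_integral_Ioc,
    ofReal_integral_eq_lintegral_ofReal hl.integrableOn (ae_of_all _ h0)]

/-- The clock pushes its own rate forward to Lebesgue measure. -/
theorem map_clock (hab : a ≤ b) (h0 : ∀ t, 0 ≤ l t) (hl : Integrable l) :
    ((volume.restrict (Icc a b)).withDensity fun t ↦ ENNReal.ofReal (l t)).map
      (fun t ↦ ∫ r in a..t, l r) = volume.restrict (Icc 0 (∫ r in a..b, l r)) := by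
  set s : ℝ → ℝ := fun t ↦ ∫ r in a..t, l r with hs
  have hmono : Monotone s := monotone_clock h0 hl
  have hcont : Continuous s := continuous_clock hl
  have hsa : s a = 0 := by simp [hs]
  have hfin : IsFiniteMeasure
      ((volume.restrict (Icc a b)).withDensity fun t ↦ ENNReal.ofReal (l t)) :=
    isFiniteMeasure_withDensity_ofReal hl.integrableOn.2
  refine Measure.ext_of_Iic _ _ fun u ↦ ?_
  rw [Measure.map_apply hcont.measurable measurableSet_Iic,
    withDensity_apply _ (hcont.measurable measurableSet_Iic),
    Measure.restrict_restrict (hcont.measurable measurableSet_Iic),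
    Measure.restrict_apply measurableSet_Iic]
  change _ = volume (Iic u ∩ Icc 0 (s b))
  rcases lt_or_ge u 0 with hu | hu
  · have h1 : s ⁻¹' Iic u ∩ Icc a b = ∅ := by
      ext t
      simp only [mem_inter_iff, mem_preimage, mem_Iic, mem_empty_iff_false, iff_false]
      rintro ⟨h, h'⟩
      have := hmono h'.1
      linarith
    have h2 : Iic u ∩ Icc 0 (s b) = ∅ := by
      ext t
      simp only [mem_inter_iff, mem_Icc, mem_Iic, mem_empty_iff_false, iff_false]
      rintro ⟨h, h', _⟩
      linarith
    simp [h1, h2]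
  have hcomp : IsCompact (s ⁻¹' Iic u ∩ Icc a b) :=
    isCompact_Icc.inter_left (isClosed_Iic.preimage hcont)
  -- The last time at which the clock shows at most `u`. Taking the last one makes the preimage
  -- exactly `[a, v]` even if the clock stands still.
  obtain ⟨v, hv, hmax⟩ := hcomp.exists_isGreatest
    ⟨a, by simpa [hsa] using hu, left_mem_Icc.2 hab⟩
  have hsb : 0 ≤ s b := hsa ▸ hmono hab
  have hsv : s v = min u (s b) := by
    refine le_antisymm (le_min hv.1 (hmono hv.2.2)) ?_
    obtain ⟨w, hw, hw'⟩ := intermediate_value_Icc hab hcont.continuousOn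
      (show min u (s b) ∈ Icc (s a) (s b) from ⟨by rw [hsa]; exact le_min hu hsb, min_le_right _ _⟩)
    rw [← hw']
    exact hmono (hmax ⟨by simp [hw'], hw⟩)
  have h1 : s ⁻¹' Iic u ∩ Icc a b = Icc a v := by
    ext t
    exact ⟨fun h ↦ ⟨h.2.1, hmax h⟩, fun h ↦ ⟨(hmono h.2).trans hv.1, h.1, h.2.trans hv.2.2⟩⟩
  have h2 : Iic u ∩ Icc 0 (s b) = Icc 0 (s v) := by
    ext t
    simp only [mem_inter_iff, mem_Icc, mem_Iic, hsv, le_min_iff]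
    tauto
  rw [h1, h2, ofReal_clock h0 hl hv.2.1]
  simp [hs]

/-- Change of variables along a clock. -/
theorem lintegral_clock (hab : a ≤ b) (h0 : ∀ t, 0 ≤ l t) (hl : Integrable l) {F : ℝ → ℝ≥0∞}
    (hF : AEMeasurable F (volume.restrict (Icc 0 (∫ r in a..b, l r)))) :
    ∫⁻ u in Icc 0 (∫ r in a..b, l r), F u =
      ∫⁻ t in Icc a b, ENNReal.ofReal (l t) * F (∫ r in a..t, l r) := by
  have hmap := map_clock hab h0 hl
  have hF' := hF
  rw [← hmap] at hF'
  rw [← hmap, lintegral_map' hF' (continuous_clock hl).aemeasurable]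
  exact lintegral_withDensity_eq_lintegral_mul₀' hl.aemeasurable.ennreal_ofReal.restrict
    (hF'.comp_aemeasurable (continuous_clock hl).aemeasurable)

variable {V : Type*} [NormedAddCommGroup V] [NormedSpace ℝ V] [FiniteDimensional ℝ V]

/-- An absolutely continuous curve may be run by a clock which stops only where the curve rests. -/
theorem exists_reparametrization {σ : ℝ → V} (hab : a ≤ b)
    (hσ : AbsolutelyContinuousOnInterval σ a b) (h0 : ∀ t, 0 ≤ l t) (hl : Integrable l)
    (hz : ∀ᵐ t, t ∈ Icc a b → l t = 0 → deriv σ t = 0) :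
    ∃ τ : ℝ → V, AbsolutelyContinuousOnInterval τ 0 (∫ r in a..b, l r) ∧
      (∀ t ∈ Icc a b, τ (∫ r in a..t, l r) = σ t) ∧
      ∀ᵐ t, t ∈ Icc a b → l t ≠ 0 → deriv σ t = l t • deriv τ (∫ r in a..t, l r) := by
  have hmap := map_clock hab h0 hl
  set s : ℝ → ℝ := fun t ↦ ∫ r in a..t, l r with hs
  change Measure.map s _ = volume.restrict (Icc 0 (s b)) at hmap
  change ∃ τ : ℝ → V, AbsolutelyContinuousOnInterval τ 0 (s b) ∧
      (∀ t ∈ Icc a b, τ (s t) = σ t) ∧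
      ∀ᵐ t, t ∈ Icc a b → l t ≠ 0 → deriv σ t = l t • deriv τ (s t)
  have hmono : Monotone s := monotone_clock h0 hl
  have hcont : Continuous s := continuous_clock hl
  have hsa : s a = 0 := by simp [hs]
  have hsb : 0 ≤ s b := hsa ▸ hmono hab
  borelize V
  set ν := (volume.restrict (Icc a b)).withDensity fun t ↦ ENNReal.ofReal (l t) with hν
  set μ := (volume.restrict (Icc a b)).withDensity fun t ↦ ‖deriv σ t‖ₑ with hμ
  have hml : AEMeasurable (fun t ↦ ENNReal.ofReal (l t)) (volume.restrict (Icc a b)) :=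
    hl.aemeasurable.ennreal_ofReal.restrict
  have hfin : IsFiniteMeasure μ := by
    refine isFiniteMeasure_withDensity ?_
    rw [Measure.restrict_congr_set Ioc_ae_eq_Icc.symm]
    exact hσ.lintegral_enorm_deriv_ne_top hab
  -- `hz` says that the curve does not move where the clock stops, so arc length `μ` is absolutely
  -- continuous with respect to the clock measure `ν`. Pushed forward to clock time, arc length
  -- therefore has a density `g` for Lebesgue measure.
  have hμν : μ ≪ ν := by
    intro A hA
    rw [hν, withDensity_apply_eq_zero' hml] at hA
    rw [hμ, withDensity_apply_eq_zero' (measurable_deriv _).enorm.aemeasurable]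
    rw [measure_eq_zero_iff_ae_notMem] at hA ⊢
    filter_upwards [hA, (ae_restrict_iff' measurableSet_Icc).2 hz] with t h1 h2
    rintro ⟨h3, h4⟩
    refine h1 ⟨?_, h4⟩
    simp only [mem_ofPred_eq, ne_eq, enorm_eq_zero, ENNReal.ofReal_eq_zero, not_le] at h3 ⊢
    exact lt_of_le_of_ne (h0 t) fun h ↦ h3 (h2 h.symm)
  have hac : μ.map s ≪ volume.restrict (Icc 0 (s b)) := hmap ▸ hμν.map hcont.measurable
  set g := (μ.map s).rnDeriv (volume.restrict (Icc 0 (s b))) with hg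
  have hgd : (volume.restrict (Icc 0 (s b))).withDensity g = μ.map s :=
    Measure.withDensity_rnDeriv_eq _ _ hac
  have hgIcc : ∀ u v, 0 ≤ u → v ≤ s b → ∫⁻ r in Ioc u v, g r = μ (s ⁻¹' Icc u v) := by
    intro u v hu hv
    rw [← Measure.map_apply hcont.measurable measurableSet_Icc, ← hgd,
      withDensity_apply _ measurableSet_Icc,
      Measure.restrict_restrict measurableSet_Icc,
      inter_eq_left.2 (Icc_subset_Icc hu hv),
      Measure.restrict_congr_set Ioc_ae_eq_Icc]
  have key : ∀ t₁ ∈ Icc a b, ∀ t₂ ∈ Icc a b, t₁ ≤ t₂ →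
      edist (σ t₁) (σ t₂) ≤ ∫⁻ r in Ioc (s t₁) (s t₂), g r := by
    intro t₁ h₁ t₂ h₂ h12
    rw [hgIcc _ _ (hsa ▸ hmono h₁.1) (hmono h₂.2)]
    refine (hσ.edist_le_lintegral h₁ h₂ h12).trans ?_
    refine le_trans ?_ (measure_mono (μ := μ)
      (fun t (ht : t ∈ Ioc t₁ t₂) ↦ (⟨hmono ht.1.le, hmono ht.2⟩ : s t ∈ Icc _ _)))
    rw [hμ, withDensity_apply _ measurableSet_Ioc, Measure.restrict_restrict measurableSet_Ioc,
      inter_eq_left.2 (Ioc_subset_Icc_self.trans (Icc_subset_Icc h₁.1 h₂.2))]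
  -- Any right inverse `r` of the clock will do: by `key`, `σ` is constant on the set of times with
  -- one clock reading.
  have hsurj : ∀ u, ∃ t, u ∈ Icc 0 (s b) → t ∈ Icc a b ∧ s t = u := by
    intro u
    by_cases hu : u ∈ Icc 0 (s b)
    · obtain ⟨t, ht, hut⟩ := intermediate_value_Icc hab hcont.continuousOn (hsa.symm ▸ hu)
      exact ⟨t, fun _ ↦ ⟨ht, hut⟩⟩
    · exact ⟨a, fun h ↦ absurd h hu⟩
  choose r hr using hsurj
  have hτs : ∀ t ∈ Icc a b, σ (r (s t)) = σ t := by
    intro t ht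
    obtain ⟨h1, h2⟩ := hr (s t) ⟨hsa ▸ hmono ht.1, hmono ht.2⟩
    rcases le_total (r (s t)) t with h | h
    · have := key _ h1 _ ht h
      rw [h2] at this
      simpa using this
    · have := key _ ht _ h1 h
      rw [h2] at this
      simpa [eq_comm] using this
  have hτ : AbsolutelyContinuousOnInterval (fun u ↦ σ (r u)) 0 (s b) := by
    refine AbsolutelyContinuousOnInterval.of_edist_le_lintegral hsb (g := g) ?_ ?_
    · rw [hgIcc _ _ le_rfl le_rfl]
      exact measure_ne_top _ _
    · intro u hu v hv huv
      obtain ⟨h1, h2⟩ := hr u hu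
      obtain ⟨h3, h4⟩ := hr v hv
      rcases le_total (r u) (r v) with h | h
      · have := key _ h1 _ h3 h
        rwa [h2, h4] at this
      · have := hmono h
        rw [h2, h4] at this
        obtain rfl := le_antisymm huv this
        simp
  refine ⟨fun u ↦ σ (r u), hτ, hτs, ?_⟩
  -- Differentiability at almost every clock reading is pulled back through `ν.map s`. It holds
  -- `ν`-almost everywhere, hence Lebesgue-almost everywhere where `l` is nonzero.
  have hd : ∀ᵐ t, t ∈ Icc a b → l t ≠ 0 → DifferentiableAt ℝ (fun u ↦ σ (r u)) (s t) := by
    have h1 : ∀ᵐ u ∂(ν.map s), DifferentiableAt ℝ (fun u ↦ σ (r u)) u := by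
      rw [hmap, ae_restrict_iff' measurableSet_Icc]
      simpa only [uIcc_of_le hsb] using hτ.ae_differentiableAt'
    have h2 := ae_of_ae_map hcont.aemeasurable h1
    rw [hν, ae_withDensity_iff_ae_restrict' hml, ae_restrict_iff'₀] at h2
    · rw [ae_restrict_iff' measurableSet_Icc] at h2
      filter_upwards [h2] with t ht h3 h4
      exact ht h3 (by simpa using lt_of_le_of_ne (h0 t) h4.symm)
    · exact hml.nullMeasurableSet_preimage (measurableSet_singleton (0 : ℝ≥0∞)).compl
  have hne : ∀ c : ℝ, ∀ᵐ t : ℝ, t ≠ c := fun c ↦ by simp [ae_iff]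
  have hsd : ∀ᵐ t, t ∈ uIcc a b → HasDerivAt s (l t) t := by
    filter_upwards [hl.intervalIntegrable (a := a) (b := b) |>.ae_hasDerivAt_integral] with t ht hm
    exact ht hm a left_mem_uIcc
  rw [uIcc_of_le hab] at hsd
  filter_upwards [hd, hsd, hne a, hne b] with t h1 h2 h3 h4 hm hlt
  have hnhds : Icc a b ∈ 𝓝 t :=
    Icc_mem_nhds (lt_of_le_of_ne hm.1 h3.symm) (lt_of_le_of_ne hm.2 h4)
  have hev : σ =ᶠ[𝓝 t] fun t ↦ σ (r (s t)) := by
    filter_upwards [hnhds] with v hv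
    exact (hτs v hv).symm
  exact ((h1 hm hlt).hasDerivAt.scomp t (h2 hm) |>.congr_of_eventuallyEq hev).deriv

end Clock

namespace NBody

variable {N d : ℕ} {m : Fin N → ℝ}

/-! ### The mass scalar product and the potential -/

/-- The mass scalar product with a fixed configuration, as a continuous linear functional. -/
noncomputable def massInnerCLM (m : Fin N → ℝ) (v : Config N d) : Config N d →L[ℝ] ℝ :=
  ∑ i, m i • (innerSL ℝ (v i)).comp (ContinuousLinearMap.proj i)

@[simp]
theorem massInnerCLM_apply (v w : Config N d) : massInnerCLM m v w = massInner m v w := by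
  simp [massInnerCLM, massInner]

theorem massInner_comm (v w : Config N d) : massInner m v w = massInner m w v := by
  simp only [massInner, real_inner_comm]

theorem massInner_add_right (u v w : Config N d) :
    massInner m u (v + w) = massInner m u v + massInner m u w := by
  simp only [← massInnerCLM_apply, map_add]

theorem massInner_sub_right (u v w : Config N d) :
    massInner m u (v - w) = massInner m u v - massInner m u w := by
  simp only [← massInnerCLM_apply, map_sub]

theorem massInner_smul_right (u v : Config N d) (r : ℝ) :
    massInner m u (r • v) = r * massInner m u v := by
  simp only [← massInnerCLM_apply, map_smul, smul_eq_mul]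

theorem massInner_add_left (u v w : Config N d) :
    massInner m (u + v) w = massInner m u w + massInner m v w := by
  rw [massInner_comm, massInner_add_right, massInner_comm w u, massInner_comm w v]

theorem massInner_sub_left (u v w : Config N d) :
    massInner m (u - v) w = massInner m u w - massInner m v w := by
  rw [massInner_comm, massInner_sub_right, massInner_comm w u, massInner_comm w v]

theorem massInner_smul_left (u v : Config N d) (r : ℝ) :
    massInner m (r • u) v = r * massInner m u v := by
  rw [massInner_comm, massInner_smul_right, massInner_comm]

theorem massNormSq_smul (r : ℝ) (v : Config N d) :
    massNormSq m (r • v) = r ^ 2 * massNormSq m v := by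
  rw [massNormSq, massInner_smul_left, massInner_smul_right, massNormSq]
  ring

theorem massNormSq_add (u v : Config N d) :
    massNormSq m (u + v) = massNormSq m u + 2 * massInner m u v + massNormSq m v := by
  simp only [massNormSq, massInner_add_left, massInner_add_right, massInner_comm v u]
  ring

theorem massNormSq_sub (u v : Config N d) :
    massNormSq m (u - v) = massNormSq m u - 2 * massInner m u v + massNormSq m v := by
  simp only [massNormSq, massInner_sub_left, massInner_sub_right, massInner_comm v u]
  ring

theorem massNormSq_nonneg (hm : ∀ i, 0 < m i) (v : Config N d) : 0 ≤ massNormSq m v := by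
  rw [massNormSq, massInner]
  exact Finset.sum_nonneg fun i _ ↦ mul_nonneg (hm i).le real_inner_self_nonneg

theorem eq_zero_of_massNormSq_eq_zero (hm : ∀ i, 0 < m i) {v : Config N d}
    (h : massNormSq m v = 0) : v = 0 := by
  rw [massNormSq, massInner,
    Finset.sum_eq_zero_iff_of_nonneg fun i _ ↦ mul_nonneg (hm i).le real_inner_self_nonneg] at h
  funext i
  simpa [(hm i).ne'] using h i (Finset.mem_univ i)

theorem massNormSq_add_le (hm : ∀ i, 0 < m i) (u v : Config N d) :
    massNormSq m (u + v) ≤ 2 * massNormSq m u + 2 * massNormSq m v := by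
  have := massNormSq_nonneg hm (u - v)
  rw [massNormSq_sub] at this
  rw [massNormSq_add]
  linarith

theorem abs_massInner_le (hm : ∀ i, 0 < m i) (u v : Config N d) :
    |massInner m u v| ≤ (∑ i, m i) * (‖u‖ * ‖v‖) := by
  rw [massInner, Finset.sum_mul]
  refine (Finset.abs_sum_le_sum_abs _ _).trans (Finset.sum_le_sum fun i _ ↦ ?_)
  rw [abs_mul, abs_of_pos (hm i)]
  refine mul_le_mul_of_nonneg_left ((abs_real_inner_le_norm _ _).trans ?_) (hm i).le
  exact mul_le_mul (norm_le_pi_norm u i) (norm_le_pi_norm v i) (norm_nonneg _) (norm_nonneg _)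

theorem sum_mass_nonneg (hm : ∀ i, 0 < m i) : 0 ≤ ∑ i, m i :=
  Finset.sum_nonneg fun i _ ↦ (hm i).le

theorem massNormSq_le (hm : ∀ i, 0 < m i) (v : Config N d) :
    massNormSq m v ≤ (∑ i, m i) * ‖v‖ ^ 2 := by
  rw [sq]
  exact (le_abs_self _).trans (abs_massInner_le hm v v)

theorem exists_norm_sq_le (hm : ∀ i, 0 < m i) :
    ∃ C, 0 ≤ C ∧ ∀ v : Config N d, ‖v‖ ^ 2 ≤ C * massNormSq m v := by
  -- The norm on `Config` is a supremum norm, so a constant that dominates every `(m i)⁻¹` is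
  -- enough.
  refine ⟨∑ i, (m i)⁻¹, Finset.sum_nonneg fun i _ ↦ (inv_pos.2 (hm i)).le, fun v ↦ ?_⟩
  have hC : 0 ≤ (∑ i, (m i)⁻¹) * massNormSq m v :=
    mul_nonneg (Finset.sum_nonneg fun i _ ↦ (inv_pos.2 (hm i)).le) (massNormSq_nonneg hm v)
  rw [← Real.le_sqrt (norm_nonneg _) hC, pi_norm_le_iff_of_nonneg (Real.sqrt_nonneg _)]
  intro i
  rw [Real.le_sqrt (norm_nonneg _) hC]
  have h1 : m i * ‖v i‖ ^ 2 ≤ massNormSq m v := by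
    rw [massNormSq, massInner, ← real_inner_self_eq_norm_sq]
    exact Finset.single_le_sum (f := fun i ↦ m i * inner ℝ (v i) (v i))
      (fun i _ ↦ mul_nonneg (hm i).le real_inner_self_nonneg) (Finset.mem_univ i)
  have h2 : (m i)⁻¹ ≤ ∑ i, (m i)⁻¹ :=
    Finset.single_le_sum (f := fun i ↦ (m i)⁻¹) (fun i _ ↦ (inv_pos.2 (hm i)).le)
      (Finset.mem_univ i)
  calc ‖v i‖ ^ 2 = (m i)⁻¹ * (m i * ‖v i‖ ^ 2) := by rw [inv_mul_cancel_left₀ (hm i).ne']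
    _ ≤ _ := mul_le_mul h2 h1 (mul_nonneg (hm i).le (sq_nonneg _))
        ((inv_pos.2 (hm i)).le.trans h2)

theorem continuous_massNormSq : Continuous (massNormSq m : Config N d → ℝ) := by
  unfold massNormSq massInner
  fun_prop

theorem measurable_massNormSq_deriv (γ : ℝ → Config N d) :
    Measurable fun t ↦ massNormSq m (deriv γ t) :=
  continuous_massNormSq.measurable.comp (measurable_deriv γ)

theorem measurable_potential : Measurable (potential m : Config N d → ℝ≥0∞) := by
  unfold potential clusterPotential
  refine Finset.measurable_fun_sum _ fun i _ ↦ Finset.measurable_fun_sum _ fun j _ ↦ ?_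
  refine Measurable.const_div ?_ _
  exact ((continuous_apply i).sub (continuous_apply j)).norm.measurable.ennreal_ofReal

/-- A single pair suffices, as its distance is at most `2 * R`. The bound keeps `U` away from 0
along a compact curve, even at `h = 0`. -/
theorem le_potential {i j : Fin N} (hij : i < j) {R : ℝ} {x : Config N d}
    (hx : ‖x‖ ≤ R) :
    ENNReal.ofReal (m i * m j) / ENNReal.ofReal (2 * R) ≤ potential m x := by
  have h1 : ENNReal.ofReal (m i * m j) / ENNReal.ofReal ‖x i - x j‖ ≤ potential m x := by
    rw [potential, clusterPotential]
    refine le_trans ?_ (Finset.single_le_sum (f := fun i ↦ ∑ j ∈ Finset.univ with i < j,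
      ENNReal.ofReal (m i * m j) / ENNReal.ofReal ‖x i - x j‖) (fun _ _ ↦ zero_le)
      (Finset.mem_univ i))
    exact Finset.single_le_sum
      (f := fun j ↦ ENNReal.ofReal (m i * m j) / ENNReal.ofReal ‖x i - x j‖) (fun _ _ ↦ zero_le)
      (by simpa using hij)
  refine le_trans (ENNReal.div_le_div_left (ENNReal.ofReal_le_ofReal ?_) _) h1
  linarith [norm_sub_le (x i) (x j), norm_le_pi_norm x i, norm_le_pi_norm x j]

/-! ### Curves -/

theorem IsCurve.mono {γ : ℝ → Config N d} {a b a' b' : ℝ} (h : IsCurve m γ a b) (ha : a ≤ a')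
    (hab : a' ≤ b') (hb : b' ≤ b) : IsCurve m γ a' b' := by
  refine ⟨h.1.mono ?_, fun t ht ↦ h.2 t ⟨ha.trans ht.1, ht.2.trans hb⟩⟩
  rw [uIcc_of_le hab, uIcc_of_le (ha.trans (hab.trans hb))]
  exact Icc_subset_Icc ha hb

theorem IsCurve.continuousOn {γ : ℝ → Config N d} {a b : ℝ} (h : IsCurve m γ a b) (hab : a ≤ b) :
    ContinuousOn γ (Icc a b) := by
  simpa [uIcc_of_le hab] using h.1.continuousOn

theorem IsCurve.congr {γ σ : ℝ → Config N d} {a b : ℝ} (h : IsCurve m γ a b) (hab : a ≤ b)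
    (he : EqOn γ σ (Icc a b)) : IsCurve m σ a b :=
  ⟨h.1.congr_eqOn (by rwa [uIcc_of_le hab]), fun t ht ↦ he ht ▸ h.2 t ht⟩

theorem IsCurve.union {γ : ℝ → Config N d} {a b c : ℝ} (hab : a ≤ b) (hbc : b ≤ c)
    (h : IsCurve m γ a b) (h' : IsCurve m γ b c) : IsCurve m γ a c := by
  refine ⟨h.1.union hab hbc h'.1, fun t ht ↦ ?_⟩
  rcases le_total t b with htb | htb
  exacts [h.2 t ⟨ht.1, htb⟩, h'.2 t ⟨htb, ht.2⟩]

theorem IsCurve.comp_sub {γ : ℝ → Config N d} {a b : ℝ} (h : IsCurve m γ a b) (hab : a ≤ b)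
    (T : ℝ) : IsCurve m (fun t ↦ γ (t - T)) (a + T) (b + T) :=
  ⟨h.1.comp_sub_const hab T, fun t ht ↦ h.2 _ ⟨by linarith [ht.1], by linarith [ht.2]⟩⟩

theorem IsCurve.ae_differentiableAt {γ : ℝ → Config N d} {a b : ℝ} (h : IsCurve m γ a b)
    (hab : a ≤ b) : ∀ᵐ t, t ∈ Icc a b → DifferentiableAt ℝ γ t := by
  simpa only [uIcc_of_le hab] using h.1.ae_differentiableAt'

theorem IsCurve.aemeasurable_potential {γ : ℝ → Config N d} {a b : ℝ} (h : IsCurve m γ a b)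
    (hab : a ≤ b) : AEMeasurable (fun t ↦ potential m (γ t)) (volume.restrict (Icc a b)) :=
  measurable_potential.comp_aemeasurable ((h.continuousOn hab).aemeasurable measurableSet_Icc)

theorem measurable_kinetic (γ : ℝ → Config N d) :
    Measurable fun t ↦ ENNReal.ofReal (massNormSq m (deriv γ t) / 2) :=
  ((measurable_massNormSq_deriv γ).div_const 2).ennreal_ofReal

theorem deriv_eq_of_eqOn {γ σ : ℝ → Config N d} {a b t : ℝ} (he : EqOn γ σ (Icc a b))
    (ht : t ∈ Ioo a b) : deriv γ t = deriv σ t :=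
  Filter.EventuallyEq.deriv_eq (he.eventuallyEq_of_mem (Icc_mem_nhds ht.1 ht.2))

theorem lagrangianAction_congr {γ σ : ℝ → Config N d} {a b : ℝ} (he : EqOn γ σ (Icc a b)) :
    lagrangianAction m γ a b = lagrangianAction m σ a b := by
  unfold lagrangianAction
  -- At the endpoints `deriv` also depends on values outside the interval.
  rw [Measure.restrict_congr_set Ioo_ae_eq_Icc.symm]
  refine setLIntegral_congr_fun measurableSet_Ioo fun t ht ↦ ?_
  rw [deriv_eq_of_eqOn he ht, he (Ioo_subset_Icc_self ht)]

theorem lagrangianAction_union (γ : ℝ → Config N d) {a b c : ℝ} (hab : a ≤ b) (hbc : b ≤ c) :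
    lagrangianAction m γ a c = lagrangianAction m γ a b + lagrangianAction m γ b c := by
  unfold lagrangianAction
  simp only [Measure.restrict_congr_set (Ioc_ae_eq_Icc (α := ℝ) (μ := volume)).symm]
  rw [← Ioc_union_Ioc_eq_Ioc hab hbc,
    lintegral_union measurableSet_Ioc (Ioc_disjoint_Ioc_of_le le_rfl)]

theorem lagrangianAction_comp_sub (γ : ℝ → Config N d) (a b T : ℝ) :
    lagrangianAction m (fun t ↦ γ (t - T)) (a + T) (b + T) = lagrangianAction m γ a b := by
  unfold lagrangianAction
  simpa [deriv_comp_sub_const] using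
    (measurePreserving_sub_right volume T).setLIntegral_comp_preimage_emb
    (MeasurableEquiv.subRight T).measurableEmbedding
    (fun t ↦ ENNReal.ofReal (massNormSq m (deriv γ t) / 2) + potential m (γ t)) (Icc a b)

theorem lagrangianAction_add (γ : ℝ → Config N d) (h : ℝ≥0) (a b : ℝ) :
    lagrangianAction m γ a b + ENNReal.ofReal (h * (b - a)) =
      ∫⁻ t in Icc a b, (ENNReal.ofReal (massNormSq m (deriv γ t) / 2) +
        (potential m (γ t) + (h : ℝ≥0∞))) := by
  simp only [← add_assoc]
  rw [lintegral_add_right _ measurable_const, lagrangianAction, setLIntegral_const,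
    Real.volume_Icc, ENNReal.ofReal_mul h.coe_nonneg, ENNReal.ofReal_coe_nnreal]

/-! ### Jacobi length and action -/

/-- Expand (√k − √2 √p)² ≥ 0. With p = U + h and k the squared speed, this compares length with
action. -/
theorem rpow_half_mul_le {p : ℝ≥0∞} {k : ℝ} (hk : 0 ≤ k) :
    ENNReal.ofReal (√2) * (p ^ (1 / 2 : ℝ) * ENNReal.ofReal (√k)) ≤ ENNReal.ofReal (k / 2) + p := by
  rcases eq_or_ne p ∞ with rfl | hp
  · simp
  lift p to ℝ≥0 using hp
  have hq : (0 : ℝ) ≤ p := p.2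
  rw [← ENNReal.ofReal_coe_nnreal (p := p), ENNReal.ofReal_rpow_of_nonneg hq (by norm_num),
    ← Real.sqrt_eq_rpow, ← ENNReal.ofReal_mul (by positivity), ← ENNReal.ofReal_mul (by positivity),
    ← ENNReal.ofReal_add (by positivity) hq]
  refine ENNReal.ofReal_le_ofReal ?_
  nlinarith [sq_nonneg (√k - √2 * √(p : ℝ)), Real.sq_sqrt hk, Real.sq_sqrt hq,
    Real.sq_sqrt (show (0 : ℝ) ≤ 2 by norm_num)]

/-- Equality makes the square (√k − √2 √p)² vanish; this is what yields conservation of energy. -/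
theorem half_eq_of_rpow_half_mul_eq {p : ℝ≥0∞} {k : ℝ} (hk : 0 ≤ k) (hp : p ≠ ∞)
    (h : ENNReal.ofReal (√2) * (p ^ (1 / 2 : ℝ) * ENNReal.ofReal (√k)) =
      ENNReal.ofReal (k / 2) + p) : k / 2 = p.toReal := by
  lift p to ℝ≥0 using hp
  have hq : (0 : ℝ) ≤ p := p.2
  rw [← ENNReal.ofReal_coe_nnreal (p := p), ENNReal.ofReal_rpow_of_nonneg hq (by norm_num),
    ← Real.sqrt_eq_rpow, ← ENNReal.ofReal_mul (by positivity), ← ENNReal.ofReal_mul (by positivity),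
    ← ENNReal.ofReal_add (by positivity) hq, ENNReal.ofReal_eq_ofReal_iff (by positivity)
    (by positivity)] at h
  have h2 := Real.sq_sqrt (show (0 : ℝ) ≤ 2 by norm_num)
  have hz : (√k - √2 * √(p : ℝ)) ^ 2 = 0 := by
    nlinarith [Real.sq_sqrt hk, Real.sq_sqrt hq]
  have hz' : √k = √2 * √(p : ℝ) := by
    have := pow_eq_zero_iff (two_ne_zero) |>.1 hz
    linarith
  have : k = 2 * p := by
    rw [← Real.sq_sqrt hk, hz', mul_pow, Real.sq_sqrt hq, h2]
  simp [this]

theorem sqrt_two_mul_jacobiLength (h : ℝ≥0) (γ : ℝ → Config N d) (a b : ℝ) :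
    ENNReal.ofReal (√2) * jacobiLength m h γ a b = ∫⁻ t in Icc a b, ENNReal.ofReal (√2) *
      ((potential m (γ t) + (h : ℝ≥0∞)) ^ (1 / 2 : ℝ) *
        ENNReal.ofReal (√(massNormSq m (deriv γ t)))) :=
  (lintegral_const_mul' _ _ ENNReal.ofReal_ne_top).symm

theorem sqrt_two_mul_jacobiLength_le (hm : ∀ i, 0 < m i) (h : ℝ≥0) (γ : ℝ → Config N d)
    (a b : ℝ) : ENNReal.ofReal (√2) * jacobiLength m h γ a b ≤
      lagrangianAction m γ a b + ENNReal.ofReal (h * (b - a)) := by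
  rw [lagrangianAction_add, sqrt_two_mul_jacobiLength]
  exact lintegral_mono fun t ↦ rpow_half_mul_le (massNormSq_nonneg hm _)

theorem configSpace_eq_zero_of_subsingleton (hm : ∀ i, 0 < m i) [Subsingleton (Fin N)]
    {x : Config N d} (hx : x ∈ configSpace m) : x = 0 := by
  funext i
  have hx' : ∑ i, m i • x i = 0 := hx
  rw [Fintype.sum_subsingleton _ i] at hx'
  exact (smul_eq_zero.1 hx').resolve_left (hm i).ne'

/-- A curve of finite Jacobi length can be run at energy `h`. -/
theorem exists_action_le_jacobiLength (hm : ∀ i, 0 < m i) {h : ℝ≥0} {σ : ℝ → Config N d}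
    {a b : ℝ} (hab : a < b) (hσ : IsCurve m σ a b) (hfin : jacobiLength m h σ a b ≠ ∞) :
    σ a = σ b ∨ ∃ (b' : ℝ) (τ : ℝ → Config N d), 1 < b' ∧ IsCurve m τ 1 b' ∧ τ 1 = σ a ∧
      τ b' = σ b ∧ lagrangianAction m τ 1 b' + ENNReal.ofReal (h * (b' - 1)) ≤
        ENNReal.ofReal (√2) * jacobiLength m h σ a b := by
  -- With at most one body `U` vanishes and has no positive lower bound, but then the configuration
  -- space is a point and every curve is a loop.
  rcases subsingleton_or_nontrivial (Fin N) with hN | hN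
  · left
    rw [configSpace_eq_zero_of_subsingleton hm (hσ.2 a (left_mem_Icc.2 hab.le)),
      configSpace_eq_zero_of_subsingleton hm (hσ.2 b (right_mem_Icc.2 hab.le))]
  obtain ⟨i, j, hij⟩ : ∃ i j : Fin N, i < j := by
    obtain ⟨i, j, hij⟩ := exists_pair_ne (Fin N)
    rcases lt_or_gt_of_ne hij with h' | h'
    exacts [⟨i, j, h'⟩, ⟨j, i, h'⟩]
  obtain ⟨R, hR⟩ := isCompact_Icc.exists_bound_of_continuousOn (hσ.continuousOn hab.le)
  set p : ℝ → ℝ≥0∞ := fun t ↦ potential m (σ t) + (h : ℝ≥0∞) with hp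
  set k : ℝ → ℝ := fun t ↦ massNormSq m (deriv σ t) with hk
  have hk0 : ∀ t, 0 ≤ k t := fun t ↦ massNormSq_nonneg hm _
  obtain ⟨c, hc, hcp⟩ : ∃ c : ℝ, 0 < c ∧ ∀ t ∈ Icc a b, ENNReal.ofReal c ≤ p t := by
    have hR' : 0 < 2 * (|R| + 1) := by positivity
    refine ⟨m i * m j / (2 * (|R| + 1)), div_pos (mul_pos (hm i) (hm j)) hR', fun t ht ↦ ?_⟩
    rw [ENNReal.ofReal_div_of_pos hR']
    exact (le_potential hij (((hR t ht).trans (le_abs_self R)).trans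
      (by linarith))).trans le_self_add
  have hpm : AEMeasurable p (volume.restrict (Icc a b)) :=
    (hσ.aemeasurable_potential hab.le).add_const _
  -- The rate of new time against old time for which the new curve has ½‖τ'‖² = U + h. At collisions
  -- `toReal` is 0, so the quotient and the rate are 0 there.
  set l : ℝ → ℝ := (Icc a b).indicator fun t ↦ √(k t / (2 * (p t).toReal)) with hl
  have hl0 : ∀ t, 0 ≤ l t := fun t ↦ indicator_nonneg (fun _ _ ↦ Real.sqrt_nonneg _) t
  have hlt : ∀ t ∈ Icc a b, l t = √(k t / (2 * (p t).toReal)) := fun t ht ↦ indicator_of_mem ht _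
  have hsqk : IntegrableOn (fun t ↦ √(k t)) (Icc a b) := by
    have h1 : IntegrableOn (fun t ↦ ‖deriv σ t‖) (Icc a b) := by
      rw [integrableOn_Icc_iff_integrableOn_Ioc]
      refine Integrable.norm ⟨(measurable_deriv σ).aestronglyMeasurable, ?_⟩
      exact (hσ.1.lintegral_enorm_deriv_ne_top hab.le).lt_top
    refine (h1.const_mul (√(∑ i, m i))).mono'
      (measurable_massNormSq_deriv σ).sqrt.aestronglyMeasurable (ae_of_all _ fun t ↦ ?_)
    rw [Real.norm_of_nonneg (Real.sqrt_nonneg _)]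
    refine (Real.sqrt_le_sqrt (massNormSq_le hm _)).trans_eq ?_
    rw [Real.sqrt_mul (sum_mass_nonneg hm), Real.sqrt_sq (norm_nonneg _)]
  have hli : Integrable l := by
    rw [hl, integrable_indicator_iff measurableSet_Icc]
    refine (hsqk.mul_const (√(2 * c))⁻¹).mono' ?_ ?_
    · exact ((measurable_massNormSq_deriv σ).aemeasurable.div
        (hpm.ennreal_toReal.const_mul 2)).sqrt.aestronglyMeasurable
    refine (ae_restrict_iff' measurableSet_Icc).2 (ae_of_all _ fun t ht ↦ ?_)
    rw [Real.norm_of_nonneg (Real.sqrt_nonneg _), ← div_eq_mul_inv, ← Real.sqrt_div (hk0 t)]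
    refine Real.sqrt_le_sqrt ?_
    rcases eq_or_ne (p t) ∞ with hpt | hpt
    · simpa [hpt] using div_nonneg (hk0 t) (by positivity)
    · have := (ENNReal.ofReal_le_iff_le_toReal hpt).1 (hcp t ht)
      exact div_le_div_of_nonneg_left (hk0 t) (by positivity) (by linarith)
  have hlz : ∀ t ∈ Icc a b, l t = 0 → k t = 0 ∨ p t = ∞ := by
    intro t ht h0
    rw [hlt t ht, Real.sqrt_eq_zero (div_nonneg (hk0 t) (by positivity)), div_eq_zero_iff] at h0
    refine h0.imp id fun h1 ↦ ?_
    by_contra hpt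
    have := (ENNReal.ofReal_le_iff_le_toReal hpt).1 (hcp t ht)
    linarith
  -- The rate vanishes only at rest or at a collision. Since the Jacobi length is finite, its
  -- integrand is finite almost everywhere, which forces zero speed at almost every collision time.
  have hz : ∀ᵐ t, t ∈ Icc a b → l t = 0 → deriv σ t = 0 := by
    have hlt' := ae_lt_top' ((hpm.pow_const (1 / 2)).mul
      (measurable_massNormSq_deriv σ).sqrt.ennreal_ofReal.aemeasurable) hfin
    rw [ae_restrict_iff' measurableSet_Icc] at hlt'
    filter_upwards [hlt'] with t h1 ht h0
    refine eq_zero_of_massNormSq_eq_zero hm ?_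
    rcases hlz t ht h0 with h2 | h2
    · exact h2
    · have h3 := h1 ht
      simp only [h2, Pi.mul_apply] at h3
      rw [ENNReal.top_rpow_of_pos (by norm_num)] at h3
      by_contra h4
      have h5 : 0 < k t := lt_of_le_of_ne (hk0 t) (Ne.symm h4)
      rw [ENNReal.top_mul] at h3
      · exact h3.ne rfl
      · simpa using h5
  obtain ⟨τ, hτ, hτs, hτd⟩ := exists_reparametrization hab.le hσ.1 hl0 hli hz
  set s : ℝ → ℝ := fun t ↦ ∫ r in a..t, l r with hs
  change AbsolutelyContinuousOnInterval τ 0 (s b) at hτ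
  change ∀ t ∈ Icc a b, τ (s t) = σ t at hτs
  have hsa : s a = 0 := by simp [hs]
  have hsb : 0 ≤ s b := hsa ▸ monotone_clock hl0 hli hab.le
  have hτc : IsCurve m τ 0 (s b) := by
    refine ⟨hτ, fun u hu ↦ ?_⟩
    obtain ⟨t, ht, rfl⟩ := intermediate_value_Icc hab.le (continuous_clock hli).continuousOn
      (show u ∈ Icc (s a) (s b) from hsa.symm ▸ hu)
    change τ (s t) ∈ _
    rw [hτs t ht]
    exact hσ.2 t ht
  have hτ0 : τ 0 = σ a := by rw [← hτs a (left_mem_Icc.2 hab.le), hsa]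
  have hτb : τ (s b) = σ b := hτs b (right_mem_Icc.2 hab.le)
  -- If no new time elapses, `τ` lives on a single instant and both ends agree.
  rcases hsb.eq_or_lt with h0 | hpos
  · left
    rw [← hτ0, ← hτb, ← h0]
  right
  have hact : lagrangianAction m τ 0 (s b) + ENNReal.ofReal (h * (s b - 0)) ≤
      ENNReal.ofReal (√2) * jacobiLength m h σ a b := by
    rw [lagrangianAction_add, sqrt_two_mul_jacobiLength]
    refine (lintegral_clock hab.le hl0 hli ((measurable_kinetic (m := m) τ).aemeasurable.add
      ((hτc.aemeasurable_potential hsb).add_const (h : ℝ≥0∞)))).trans_le ?_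
    refine lintegral_mono_ae ((ae_restrict_iff' measurableSet_Icc).2 ?_)
    filter_upwards [hτd] with t h1 ht
    change ENNReal.ofReal (l t) * (ENNReal.ofReal (massNormSq m (deriv τ (s t)) / 2) +
      (potential m (τ (s t)) + (h : ℝ≥0∞))) ≤ _
    rw [hτs t ht]
    by_cases hl' : l t = 0
    · simp [hl']
    have hpt : p t ≠ ∞ := by
      rintro h2
      rw [hlt t ht, h2] at hl'
      simp at hl'
    have hq : 0 < (p t).toReal := hc.trans_le ((ENNReal.ofReal_le_iff_le_toReal hpt).1 (hcp t ht))
    have hlsq : l t ^ 2 = k t / (2 * (p t).toReal) := by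
      rw [hlt t ht, Real.sq_sqrt (div_nonneg (hk0 t) (by positivity))]
    have hkl : k t = l t ^ 2 * massNormSq m (deriv τ (s t)) := by
      rw [hk]
      simp only
      rw [h1 ht hl', massNormSq_smul]
    have hspeed : massNormSq m (deriv τ (s t)) / 2 = (p t).toReal := by
      have h3 : l t ^ 2 ≠ 0 := pow_ne_zero 2 hl'
      rw [eq_div_iff (by positivity), hkl] at hlsq
      have := mul_left_cancel₀ h3 hlsq
      linarith
    rw [hspeed]
    change ENNReal.ofReal (l t) * (ENNReal.ofReal (p t).toReal + p t) ≤
      ENNReal.ofReal (√2) * (p t ^ (1 / 2 : ℝ) * ENNReal.ofReal (√(k t)))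
    have hpe : p t = ENNReal.ofReal (p t).toReal := (ENNReal.ofReal_toReal hpt).symm
    set q := (p t).toReal
    rw [hpe, ENNReal.ofReal_rpow_of_nonneg hq.le (by norm_num), ← Real.sqrt_eq_rpow,
      ← ENNReal.ofReal_add hq.le hq.le, ← ENNReal.ofReal_mul (hl0 t),
      ← ENNReal.ofReal_mul (by positivity), ← ENNReal.ofReal_mul (by positivity)]
    refine ENNReal.ofReal_le_ofReal (le_of_eq ?_)
    rw [hlt t ht, Real.sqrt_div (hk0 t)]
    change √(k t) / √(2 * q) * (q + q) = _
    rw [div_mul_eq_mul_div, ← two_mul, div_eq_iff (Real.sqrt_pos.2 (by positivity)).ne']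
    calc √(k t) * (2 * q) = √(k t) * (√2 ^ 2 * √q ^ 2) := by
          rw [Real.sq_sqrt hq.le, Real.sq_sqrt (by norm_num)]
      _ = _ := by
          rw [Real.sqrt_mul (by norm_num)]
          ring
  -- Shifted to start at time 1, because competitors for the free-time problem live in `[1, ∞)`.
  refine ⟨s b + 1, fun t ↦ τ (t - 1), by linarith, ?_, by simpa using hτ0, by simpa using hτb, ?_⟩
  · simpa using hτc.comp_sub hsb 1
  · have := lagrangianAction_comp_sub (m := m) τ 0 (s b) 1
    rw [zero_add] at this
    rw [this]
    simpa using hact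

/-! ### Consequences of free-time minimality -/

/-- Cutting out the loop is a legitimate competitor: `x` on `[b, b + 1]` has the same ends as `x` on
`[a, b + 1]`. The extra unit of time is there because a competitor needs an interval of positive
length. -/
theorem IsFreeTimeMinimizer.action_eq_zero_of_loop {h : ℝ≥0} {x : ℝ → Config N d}
    (hx : IsFreeTimeMinimizer m h (Ici 1) x) {a b : ℝ} (ha : 1 ≤ a) (hab : a < b)
    (hloop : x a = x b) : lagrangianAction m x a b + ENNReal.ofReal (h * (b - a)) = 0 := by
  have hsub : ∀ s t : ℝ, 1 ≤ s → Icc s t ⊆ Ici 1 := fun s t hs u hu ↦ hs.trans hu.1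
  obtain ⟨hc, -, hmin⟩ := hx a (b + 1) (by linarith) (hsub _ _ ha)
  obtain ⟨hc', hfin, -⟩ := hx b (b + 1) (by linarith) (hsub _ _ (by linarith))
  have := hmin b (b + 1) x (by linarith) (hsub _ _ (by linarith)) hc' hloop.symm rfl
  rw [lagrangianAction_union x hab.le (by linarith : b ≤ b + 1),
    show (h : ℝ) * (b + 1 - a) = h * (b - a) + h * (b + 1 - b) by ring,
    ENNReal.ofReal_add (mul_nonneg h.coe_nonneg (by linarith)) (mul_nonneg h.coe_nonneg (by linarith)),
    add_add_add_comm] at this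
  have hne : lagrangianAction m x b (b + 1) + ENNReal.ofReal (h * (b + 1 - b)) ≠ ∞ :=
    ENNReal.add_ne_top.2 ⟨hfin, ENNReal.ofReal_ne_top⟩
  exact nonpos_iff_eq_zero.1 (ENNReal.le_of_add_le_add_right hne (by rwa [zero_add]))

theorem IsFreeTimeMinimizer.action_le_jacobiLength (hm : ∀ i, 0 < m i) {h : ℝ≥0}
    {x : ℝ → Config N d} (hx : IsFreeTimeMinimizer m h (Ici 1) x) {a b : ℝ} (ha : 1 ≤ a)
    (hab : a < b) {a' b' : ℝ} {σ : ℝ → Config N d} (hab' : a' < b') (hσ : IsCurve m σ a' b')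
    (hσa : σ a' = x a) (hσb : σ b' = x b) :
    lagrangianAction m x a b + ENNReal.ofReal (h * (b - a)) ≤
      ENNReal.ofReal (√2) * jacobiLength m h σ a' b' := by
  rcases eq_or_ne (jacobiLength m h σ a' b') ∞ with htop | hfin
  · rw [htop, ENNReal.mul_top (by simp)]
    exact le_top
  rcases exists_action_le_jacobiLength hm hab' hσ hfin with hloop | ⟨c, τ, hc, hτ, h1, h2, hle⟩
  · rw [hx.action_eq_zero_of_loop ha hab (by rw [← hσa, ← hσb, hloop])]
    exact zero_le
  · exact ((hx a b hab fun u hu ↦ ha.trans hu.1).2.2 1 c τ hc (fun u hu ↦ hu.1) hτ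
      (h1.trans hσa) (h2.trans hσb)).trans hle

/-- The action of `x` plus `h` times the elapsed time lies between √2 times the length of `x` and √2
times the length of any competitor. -/
theorem IsFreeTimeMinimizer.isMinimizingGeodesic (hm : ∀ i, 0 < m i) {h : ℝ≥0}
    {x : ℝ → Config N d} (hx : IsFreeTimeMinimizer m h (Ici 1) x) {a b : ℝ} (ha : 1 ≤ a)
    (hab : a < b) : IsMinimizingGeodesic m h x a b := by
  obtain ⟨hc, hfin, -⟩ := hx a b hab fun u hu ↦ ha.trans hu.1
  have hle := sqrt_two_mul_jacobiLength_le hm h x a b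
  have h2 : ENNReal.ofReal (√2) ≠ 0 := by simp
  refine ⟨hc, fun htop ↦ ?_, fun a' b' σ hab' hσ h1 h3 ↦ ?_⟩
  · rw [htop, ENNReal.mul_top h2, top_le_iff] at hle
    exact ENNReal.add_ne_top.2 ⟨hfin, ENNReal.ofReal_ne_top⟩ hle
  · exact (ENNReal.mul_le_mul_iff_right h2 ENNReal.ofReal_ne_top).1
      (hle.trans (hx.action_le_jacobiLength hm ha hab hab' hσ h1 h3))

theorem IsFreeTimeMinimizer.ae_energy_eq (hm : ∀ i, 0 < m i) {h : ℝ≥0}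
    {x : ℝ → Config N d} (hx : IsFreeTimeMinimizer m h (Ici 1) x) :
    ∀ᵐ t ∂(volume.restrict (Ioi (1 : ℝ))), potential m (x t) ≠ ∞ ∧
      massNormSq m (deriv x t) / 2 - (potential m (x t)).toReal = h := by
  have hU : Ioi (1 : ℝ) = ⋃ n : ℕ, Ioc 1 (n + 2 : ℝ) := by
    ext t
    simp only [mem_Ioi, mem_iUnion, mem_Ioc, exists_and_left, iff_self_and]
    intro _
    obtain ⟨n, hn⟩ := exists_nat_ge t
    exact ⟨n, by linarith⟩
  rw [hU, ae_restrict_iUnion_iff]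
  intro n
  have hab : (1 : ℝ) < n + 2 := by
    have : (0 : ℝ) ≤ n := n.cast_nonneg
    linarith
  rw [Measure.restrict_congr_set Ioc_ae_eq_Icc]
  obtain ⟨hc, hfin, -⟩ := hx 1 (n + 2) hab fun u hu ↦ hu.1
  -- With `x` as its own competitor, the larger side of the pointwise inequality of the means has
  -- the smaller integral, so equality holds almost everywhere.
  have hle := hx.action_le_jacobiLength hm le_rfl hab hab hc rfl rfl
  have hpm := hc.aemeasurable_potential hab.le
  have hAfin : lagrangianAction m x 1 (n + 2) + ENNReal.ofReal (h * (n + 2 - 1)) ≠ ∞ :=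
    ENNReal.add_ne_top.2 ⟨hfin, ENNReal.ofReal_ne_top⟩
  have hmeas := (measurable_kinetic (m := m) x).aemeasurable.add (hpm.add_const (h : ℝ≥0∞))
  rw [lagrangianAction_add] at hAfin hle
  rw [sqrt_two_mul_jacobiLength] at hle
  have heq := ae_eq_of_ae_le_of_lintegral_le
    (ae_of_all _ fun t ↦ rpow_half_mul_le (massNormSq_nonneg hm (deriv x t)))
    ((lintegral_mono fun t ↦ rpow_half_mul_le (massNormSq_nonneg hm (deriv x t))).trans_lt
      hAfin.lt_top).ne hmeas hle
  filter_upwards [heq, ae_lt_top' hmeas hAfin] with t h1 h2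
  have hp : potential m (x t) + (h : ℝ≥0∞) ≠ ∞ :=
    ((ENNReal.add_lt_top.1 h2).2).ne
  have hp' : potential m (x t) ≠ ∞ := fun h3 ↦ hp (by simp [h3])
  refine ⟨hp', ?_⟩
  have := half_eq_of_rpow_half_mul_eq (massNormSq_nonneg hm _) hp h1
  rw [ENNReal.toReal_add hp' ENNReal.coe_ne_top] at this
  simp [this]

end NBody

/-! ### Asymptotics of powers and of the reference path -/

theorem exists_abs_rpow_shift_le {p : ℝ} (hp : p ≤ 1) (T : ℝ) :
    ∃ C, 0 ≤ C ∧ ∀ t : ℝ, 1 ≤ t → 1 ≤ t - T → |(t - T) ^ p - t ^ p| ≤ C * t ^ (p - 1) := by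
  have hT : 0 < 1 + |T| := by positivity
  refine ⟨|p| * ((1 + |T|)⁻¹) ^ (p - 1) * |T|, by positivity, fun t ht htT ↦ ?_⟩
  -- A multiple of `t` below both `t` and `t - T`. On `[w, ∞)` the derivative of the power is
  -- largest in modulus at `w`, and the mean value inequality applies.
  set w := (1 + |T|)⁻¹ * t with hw
  have hw0 : 0 < w := by positivity
  have h1 : w ≤ t := by
    refine mul_le_of_le_one_left (by linarith) (inv_le_one_of_one_le₀ ?_)
    linarith [abs_nonneg T]
  have h2 : w ≤ t - T := by
    rw [hw, inv_mul_le_iff₀ hT]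
    nlinarith [le_abs_self T, abs_nonneg T]
  have h3 := (convex_Ici w).norm_image_sub_le_of_norm_hasDerivWithin_le
    (f := fun x : ℝ ↦ x ^ p) (f' := fun x ↦ p * x ^ (p - 1)) (C := |p| * w ^ (p - 1))
    (fun x hx ↦ (Real.hasDerivAt_rpow_const (Or.inl (hw0.trans_le hx).ne')).hasDerivWithinAt)
    (fun x hx ↦ by
      rw [norm_mul, Real.norm_eq_abs, Real.norm_of_nonneg (Real.rpow_nonneg (hw0.le.trans hx) _)]
      exact mul_le_mul_of_nonneg_left (Real.rpow_le_rpow_of_nonpos hw0 hx (by linarith))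
        (abs_nonneg p))
    (show t ∈ Ici w from h1) (show t - T ∈ Ici w from h2)
  rw [Real.norm_eq_abs, Real.norm_eq_abs, hw, Real.mul_rpow (by positivity) (by linarith),
    show t - T - t = -T by ring, abs_neg] at h3
  linarith

/-- On a far window of fixed length `f` is uniformly close to `L`. The window is oriented: `T` may
be negative, when the competitor is faster. -/
theorem tendsto_integral_window {f : ℝ → ℝ} {L : ℝ} (hf : ContinuousOn f (Ici 1))
    (hlim : Tendsto f atTop (𝓝 L)) (T : ℝ) :
    Tendsto (fun R ↦ ∫ t in R..(R + T), f t) atTop (𝓝 (T * L)) := by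
  rw [Metric.tendsto_atTop] at hlim ⊢
  intro ε hε
  obtain ⟨M, hM⟩ := hlim (ε / (|T| + 1)) (by positivity)
  refine ⟨max M 1 + |T|, fun R hR ↦ ?_⟩
  have hsub : ∀ t ∈ uIcc R (R + T), M ≤ t ∧ 1 ≤ t := fun t ht ↦ by
    have h1 : R - |T| ≤ t := by
      refine le_trans ?_ ht.1
      rw [le_inf_iff]
      constructor <;> linarith [neg_abs_le T, abs_nonneg T]
    have := le_max_left M 1
    have := le_max_right M 1
    constructor <;> linarith
  have hint : IntervalIntegrable f volume R (R + T) :=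
    (hf.mono fun t ht ↦ (hsub t ht).2).intervalIntegrable
  have h1 : ∫ t in R..(R + T), (f t - L) = (∫ t in R..(R + T), f t) - T * L := by
    rw [intervalIntegral.integral_sub hint intervalIntegrable_const]
    simp
  rw [Real.dist_eq, ← h1, ← Real.norm_eq_abs]
  have h2 := intervalIntegral.norm_integral_le_of_norm_le_const (a := R) (b := R + T)
    (f := fun t ↦ f t - L) (C := ε / (|T| + 1)) fun t ht ↦
      (hM t (hsub t (uIoc_subset_uIcc ht)).1).le
  refine h2.trans_lt ?_
  rw [add_sub_cancel_left, div_mul_eq_mul_div, div_lt_iff₀ (by positivity)]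
  nlinarith [abs_nonneg T]

/-! ### Tame renormalizing terms -/

/-- Renormalizing terms which are continuous, vanish at infinity and change integrably under time
shifts. -/
structure IsTame (P : ℝ → ℝ) : Prop where
  continuousOn : ContinuousOn P (Ici 1)
  tendsto_zero : Tendsto P atTop (𝓝 0)
  integrableOn_shift : ∀ T R : ℝ, 1 ≤ R → 1 ≤ R - T →
    IntegrableOn (fun t ↦ P (t - T) - P t) (Ioi R)

theorem IsTame.congr {P Q : ℝ → ℝ} (hP : IsTame P) (h : EqOn P Q (Ici 1)) : IsTame Q where
  continuousOn := hP.continuousOn.congr fun t ht ↦ (h ht).symm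
  tendsto_zero := hP.tendsto_zero.congr' (by
    filter_upwards [eventually_ge_atTop 1] with t ht using h ht)
  integrableOn_shift T R hR hRT := (hP.integrableOn_shift T R hR hRT).congr_fun (fun t ht ↦ by
    have ht' : R < t := ht
    simp only
    rw [h (show t ∈ Ici 1 from hR.trans ht'.le),
      h (show t - T ∈ Ici (1 : ℝ) by simp only [mem_Ici]; linarith)]) measurableSet_Ioi

theorem IsTame.const_mul {P : ℝ → ℝ} (hP : IsTame P) (k : ℝ) : IsTame fun t ↦ k * P t where
  continuousOn := hP.continuousOn.const_mul k
  tendsto_zero := by simpa using hP.tendsto_zero.const_mul k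
  integrableOn_shift T R hR hRT := by
    simpa only [IntegrableOn, mul_sub] using (hP.integrableOn_shift T R hR hRT).const_mul k

theorem IsTame.sum {ι : Type*} (s : Finset ι) {P : ι → ℝ → ℝ} (hP : ∀ i ∈ s, IsTame (P i)) :
    IsTame fun t ↦ ∑ i ∈ s, P i t where
  continuousOn := continuousOn_finsetSum s fun i hi ↦ (hP i hi).continuousOn
  tendsto_zero := by simpa using tendsto_finsetSum s fun i hi ↦ (hP i hi).tendsto_zero
  integrableOn_shift T R hR hRT := by
    simpa only [IntegrableOn, ← Finset.sum_sub_distrib] using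
      integrable_finsetSum s fun i hi ↦ (hP i hi).integrableOn_shift T R hR hRT

theorem IsTame.add {P Q : ℝ → ℝ} (hP : IsTame P) (hQ : IsTame Q) : IsTame fun t ↦ P t + Q t where
  continuousOn := hP.continuousOn.add hQ.continuousOn
  tendsto_zero := by simpa using hP.tendsto_zero.add hQ.tendsto_zero
  integrableOn_shift T R hR hRT := by
    simp only [add_sub_add_comm]
    exact (hP.integrableOn_shift T R hR hRT).add (hQ.integrableOn_shift T R hR hRT)

theorem continuousOn_rpow_Ici (p : ℝ) : ContinuousOn (fun t : ℝ ↦ t ^ p) (Ici 1) :=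
  fun t ht ↦ (Real.continuousAt_rpow_const t p
    (Or.inl (zero_lt_one.trans_le ht).ne')).continuousWithinAt

theorem integrableOn_rpow_of_le {p R : ℝ} (hp : p < -1) (hR : 1 ≤ R) :
    IntegrableOn (fun t : ℝ ↦ t ^ p) (Ioi R) :=
  integrableOn_Ioi_rpow_of_lt hp (by linarith)

theorem continuousOn_comp_sub {V : Type*} [TopologicalSpace V] {f : ℝ → V}
    (hf : ContinuousOn f (Ici 1)) {R T : ℝ} (hRT : 1 ≤ R - T) :
    ContinuousOn (fun t ↦ f (t - T)) (Ici R) :=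
  hf.comp (by fun_prop) fun t (ht : R ≤ t) ↦ show 1 ≤ t - T by linarith

theorem integrableOn_comp_sub {f : ℝ → ℝ} (hf : IntegrableOn f (Ioi 1)) {T R : ℝ}
    (hRT : 1 ≤ R - T) : IntegrableOn (fun t ↦ f (t - T)) (Ioi R) := by
  have h2 : IntegrableOn (fun t ↦ f (t - T)) (Ioi (1 + T)) := by
    rw [← (measurePreserving_sub_right volume T).integrableOn_comp_preimage
      (MeasurableEquiv.subRight T).measurableEmbedding] at hf
    simpa [Function.comp_def] using hf
  exact h2.mono_set (Ioi_subset_Ioi (by linarith))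

/-- The power itself need not be integrable, but its shift difference gains one order of decay, and
p − 1 < −1. -/
theorem isTame_rpow {p : ℝ} (hp : p < 0) : IsTame fun t ↦ t ^ p where
  continuousOn := continuousOn_rpow_Ici p
  tendsto_zero := by simpa using tendsto_rpow_neg_atTop (neg_pos.2 hp)
  integrableOn_shift T R hR hRT := by
    obtain ⟨C, -, hC⟩ := exists_abs_rpow_shift_le (p := p) (by linarith) T
    refine ((integrableOn_rpow_of_le (p := p - 1) (by linarith) hR).const_mul C).mono' ?_ ?_
    · exact (((continuousOn_comp_sub (continuousOn_rpow_Ici p) hRT).sub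
        ((continuousOn_rpow_Ici p).mono (Ici_subset_Ici.2 hR))).mono
        Ioi_subset_Ici_self).aestronglyMeasurable measurableSet_Ioi
    · refine (ae_restrict_iff' measurableSet_Ioi).2 (ae_of_all _ fun t (ht : R < t) ↦ ?_)
      exact hC t (by linarith) (by linarith)

theorem isTame_of_integrable {P : ℝ → ℝ} (hc : ContinuousOn P (Ici 1)) {p C : ℝ} (hp : p < -1)
    (hb : ∀ t, 1 ≤ t → |P t| ≤ C * t ^ p) : IsTame P where
  continuousOn := hc
  tendsto_zero := by
    have h1 : Tendsto (fun t : ℝ ↦ C * t ^ p) atTop (𝓝 0) := by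
      have := (isTame_rpow (show p < 0 by linarith)).const_mul C
      exact this.tendsto_zero
    refine squeeze_zero_norm' ?_ h1
    filter_upwards [eventually_ge_atTop 1] with t ht using hb t ht
  integrableOn_shift T R hR hRT := by
    have h1 : IntegrableOn P (Ioi 1) := by
      refine ((integrableOn_rpow_of_le hp le_rfl).const_mul C).mono'
        ((hc.mono Ioi_subset_Ici_self).aestronglyMeasurable measurableSet_Ioi) ?_
      exact (ae_restrict_iff' measurableSet_Ioi).2 (ae_of_all _ fun t (ht : 1 < t) ↦ hb t ht.le)
    exact (integrableOn_comp_sub h1 hRT).sub (h1.mono_set (Ioi_subset_Ioi hR))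

/-! ### Inverse distance of two bodies along the reference path -/

section Pair

variable {V : Type*} [NormedAddCommGroup V] [NormedSpace ℝ V]

/-- Divided by `t`, the norm is continuous, positive and tends to ‖u‖ > 0. Compactness bounds it
below before the limit takes over. -/
theorem exists_pos_mul_le_norm {u v : V} (hu : u ≠ 0)
    (h : ∀ t : ℝ, 1 ≤ t → t • u + t ^ (2 / 3 : ℝ) • v ≠ 0) :
    ∃ k, 0 < k ∧ ∀ t : ℝ, 1 ≤ t → k * t ≤ ‖t • u + t ^ (2 / 3 : ℝ) • v‖ := by
  set f : ℝ → ℝ := fun t ↦ ‖u + t ^ (-(1 / 3) : ℝ) • v‖ with hf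
  have hfc : ContinuousOn f (Ici 1) :=
    (continuousOn_const.add ((continuousOn_rpow_Ici _).smul continuousOn_const)).norm
  have hft : ∀ t : ℝ, 1 ≤ t → ‖t • u + t ^ (2 / 3 : ℝ) • v‖ = f t * t := fun t ht ↦ by
    have h0 : 0 < t := by linarith
    have h1 : t • u + t ^ (2 / 3 : ℝ) • v = t • (u + t ^ (-(1 / 3) : ℝ) • v) := by
      rw [smul_add, smul_smul]
      congr 2
      rw [← Real.rpow_one_add' h0.le (by norm_num)]
      norm_num
    rw [h1, norm_smul, Real.norm_of_nonneg h0.le, mul_comm]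
  have hlim : Tendsto f atTop (𝓝 ‖u‖) := by
    have h1 : Tendsto (fun t : ℝ ↦ t ^ (-(1 / 3) : ℝ)) atTop (𝓝 0) :=
      tendsto_rpow_neg_atTop (by norm_num)
    simpa [hf] using ((h1.smul_const v).const_add u).norm
  obtain ⟨M, hM⟩ := eventually_atTop.1 (hlim.eventually_const_le
    (show ‖u‖ / 2 < ‖u‖ by linarith [norm_pos_iff.2 hu]))
  obtain ⟨w, hw, hmin⟩ := isCompact_Icc.exists_isMinOn (s := Icc 1 (max M 1))
    ⟨1, le_rfl, le_max_right _ _⟩ (hfc.mono Icc_subset_Ici_self)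
  have hfw : 0 < f w := by
    have h1 : 0 < f w * w := by
      rw [← hft w hw.1]
      exact norm_pos_iff.2 (h w hw.1)
    exact (pos_iff_pos_of_mul_pos h1).2 (by linarith [hw.1])
  refine ⟨min (f w) (‖u‖ / 2), lt_min hfw (by linarith [norm_pos_iff.2 hu]), fun t ht ↦ ?_⟩
  rw [hft t ht]
  refine mul_le_mul_of_nonneg_right ?_ (by linarith)
  rcases le_total t (max M 1) with h1 | h1
  · exact (min_le_left _ _).trans (hmin ⟨ht, h1⟩)
  · exact (min_le_right _ _).trans (hM t ((le_max_left _ _).trans h1))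

/-- For `u = 0` this is a multiple of t^(−2/3). Otherwise the leading part 1/(‖u‖t) is tame and the
remainder is O(t^(2/3) / t²), hence integrable. -/
theorem isTame_inv_norm {u v : V} (h : ∀ t : ℝ, 1 ≤ t → t • u + t ^ (2 / 3 : ℝ) • v ≠ 0) :
    IsTame fun t ↦ ‖t • u + t ^ (2 / 3 : ℝ) • v‖⁻¹ := by
  rcases eq_or_ne u 0 with rfl | hu
  · refine ((isTame_rpow (p := -(2 / 3)) (by norm_num)).const_mul ‖v‖⁻¹).congr fun t ht ↦ ?_
    have h0 : (0 : ℝ) ≤ t := zero_le_one.trans ht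
    simp only
    rw [smul_zero, zero_add, norm_smul, Real.norm_of_nonneg (Real.rpow_nonneg h0 _),
      Real.rpow_neg h0, mul_inv, mul_comm]
  obtain ⟨k, hk, hkt⟩ := exists_pos_mul_le_norm hu h
  have hu' := norm_pos_iff.2 hu
  have hc : ContinuousOn (fun t : ℝ ↦ ‖t • u + t ^ (2 / 3 : ℝ) • v‖⁻¹) (Ici 1) := by
    refine ContinuousOn.inv₀ (ContinuousOn.norm ?_) fun t ht ↦ norm_ne_zero_iff.2 (h t ht)
    exact (continuousOn_id.smul continuousOn_const).add
      ((continuousOn_rpow_Ici _).smul continuousOn_const)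
  have h1 := (isTame_rpow (p := -1) (by norm_num)).const_mul ‖u‖⁻¹
  have h2 : IsTame fun t ↦ ‖t • u + t ^ (2 / 3 : ℝ) • v‖⁻¹ - ‖u‖⁻¹ * t ^ (-1 : ℝ) := by
    refine isTame_of_integrable (hc.sub h1.continuousOn) (p := -(4 / 3)) (C := ‖v‖ / (k * ‖u‖))
      (by norm_num) fun t ht ↦ ?_
    have h0 : 0 < t := by linarith
    have hp : 0 < ‖t • u + t ^ (2 / 3 : ℝ) • v‖ := norm_pos_iff.2 (h t ht)
    have h3 : ‖t • u‖ = ‖u‖ * t := by rw [norm_smul, Real.norm_of_nonneg h0.le, mul_comm]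
    have h4 : |‖t • u‖ - ‖t • u + t ^ (2 / 3 : ℝ) • v‖| ≤ t ^ (2 / 3 : ℝ) * ‖v‖ := by
      refine (abs_norm_sub_norm_le _ _).trans_eq ?_
      rw [sub_add_cancel_left, norm_neg, norm_smul, Real.norm_of_nonneg (Real.rpow_nonneg h0.le _)]
    rw [Real.rpow_neg_one, ← mul_inv, ← h3, inv_sub_inv hp.ne' (by rw [h3]; positivity), abs_div,
      abs_of_pos (mul_pos hp (by rw [h3]; positivity))]
    calc _ ≤ t ^ (2 / 3 : ℝ) * ‖v‖ / (k * t * (‖u‖ * t)) := by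
          refine div_le_div₀ (by positivity) h4 (by positivity) ?_
          rw [h3]
          exact mul_le_mul_of_nonneg_right (hkt t ht) (by positivity)
      _ = _ := by
          rw [show (-(4 / 3) : ℝ) = 2 / 3 - 2 by norm_num, Real.rpow_sub h0, Real.rpow_two]
          field_simp
  simpa using h2.add h1

theorem absolutelyContinuous_smul_add_rpow_smul (u v : V) {s t : ℝ} (hs : 1 ≤ s) (hst : s ≤ t) :
    AbsolutelyContinuousOnInterval (fun r : ℝ ↦ r • u + r ^ (2 / 3 : ℝ) • v) s t := by
  refine ContDiffOn.absolutelyContinuousOnInterval fun r hr ↦ ?_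
  rw [uIcc_of_le hst] at hr
  have h0 : r ≠ 0 := by linarith [hr.1]
  exact ((contDiffAt_id.smul contDiffAt_const).add
    ((Real.contDiffAt_rpow_const_of_ne h0).smul contDiffAt_const)).contDiffWithinAt

end Pair

namespace NBody

variable {N d : ℕ} {m : Fin N → ℝ}

theorem isTame_of_isReferencePotential (hm : ∀ i, 0 < m i) {a c : Config N d} {P : ℝ → ℝ}
    (hP : IsReferencePotential m a c P) : IsTame P := by
  rcases hP with ⟨hfree, rfl⟩ | rfl
  · have hterm : ∀ i j : Fin N, i < j → IsTame fun t ↦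
        m i * m j * ‖t • (a i - a j) + t ^ (2 / 3 : ℝ) • (c i - c j)‖⁻¹ := fun i j hij ↦ by
      refine (isTame_inv_norm fun t ht h0 ↦ ?_).const_mul _
      refine hfree t ht i j hij.ne (sub_eq_zero.1 ?_)
      rw [← h0]
      simp only [refPath, Pi.add_apply, Pi.smul_apply, smul_sub]
      abel
    refine (IsTame.sum Finset.univ fun i _ ↦ IsTame.sum {j | i < j} fun j hj ↦
      hterm i j (by simpa using hj)).congr fun t ht ↦ ?_
    have hpos : ∀ i j : Fin N, i < j → 0 < ‖refPath a c t i - refPath a c t j‖ := fun i j hij ↦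
      norm_pos_iff.2 (sub_ne_zero.2 (hfree t ht i j hij.ne))
    have hfin : ∀ i j : Fin N, i < j → ENNReal.ofReal (m i * m j) /
        ENNReal.ofReal ‖refPath a c t i - refPath a c t j‖ ≠ ∞ := fun i j hij ↦
      ENNReal.div_ne_top ENNReal.ofReal_ne_top (by simpa using hpos i j hij)
    simp only [potential, clusterPotential]
    rw [ENNReal.toReal_sum fun i _ ↦ ENNReal.sum_ne_top.2 fun j hj ↦ hfin i j (by simpa using hj)]
    refine Finset.sum_congr rfl fun i _ ↦ ?_
    rw [ENNReal.toReal_sum fun j hj ↦ hfin i j (by simpa using hj)]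
    refine Finset.sum_congr rfl fun j _ ↦ ?_
    rw [ENNReal.toReal_div, ENNReal.toReal_ofReal (mul_pos (hm i) (hm j)).le,
      ENNReal.toReal_ofReal (norm_nonneg _), div_eq_mul_inv]
    congr 3
    simp only [refPath, Pi.add_apply, Pi.smul_apply, smul_sub]
    abel
  · refine IsTame.sum Finset.univ fun i _ ↦ IsTame.sum _ fun j _ ↦ ?_
    split_ifs
    · refine ((isTame_rpow (p := -(2 / 3)) (by norm_num)).const_mul
        (m i * m j / ‖c i - c j‖)).congr fun t ht ↦ ?_
      simp only
      rw [Real.rpow_neg (zero_le_one.trans ht), ← div_eq_mul_inv, div_div]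
    · refine ((isTame_rpow (p := -1) (by norm_num)).const_mul
        (m i * m j / ‖a i - a j‖)).congr fun t ht ↦ ?_
      simp only
      rw [Real.rpow_neg_one, ← div_eq_mul_inv, div_div]

/-! ### Derivatives of the reference path -/

/-- The velocity of the reference path. -/
noncomputable def refVelocity (a c : Config N d) (t : ℝ) : Config N d :=
  a + (2 / 3 * t ^ (-(1 / 3) : ℝ)) • c

theorem hasDerivAt_refPath (a c : Config N d) {t : ℝ} (ht : 0 < t) :
    HasDerivAt (refPath a c) (refVelocity a c t) t := by
  have h1 : HasDerivAt (fun t : ℝ ↦ t ^ (2 / 3 : ℝ)) (2 / 3 * t ^ (2 / 3 - 1 : ℝ)) t :=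
    Real.hasDerivAt_rpow_const (Or.inl ht.ne')
  have := ((hasDerivAt_id t).smul_const a).add (h1.smul_const c)
  rw [one_smul, show (2 / 3 - 1 : ℝ) = -(1 / 3) by norm_num] at this
  exact this

theorem hasDerivAt_refVelocity (a c : Config N d) {t : ℝ} (ht : 0 < t) :
    HasDerivAt (refVelocity a c) ((-(2 / 9) * t ^ (-(4 / 3) : ℝ)) • c) t := by
  have h1 : HasDerivAt (fun t : ℝ ↦ t ^ (-(1 / 3) : ℝ))
      (-(1 / 3) * t ^ (-(1 / 3) - 1 : ℝ)) t := Real.hasDerivAt_rpow_const (Or.inl ht.ne')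
  have := ((h1.const_mul (2 / 3)).smul_const c).const_add a
  rw [← mul_assoc, show (-(1 / 3) - 1 : ℝ) = -(4 / 3) by norm_num,
    show (2 / 3 * -(1 / 3) : ℝ) = -(2 / 9) by norm_num] at this
  exact this

theorem deriv_deriv_refPath (a c : Config N d) {t : ℝ} (ht : 0 < t) :
    deriv (deriv (refPath a c)) t = (-(2 / 9) * t ^ (-(4 / 3) : ℝ)) • c := by
  have : deriv (refPath a c) =ᶠ[𝓝 t] refVelocity a c := by
    filter_upwards [lt_mem_nhds ht] with s hs using (hasDerivAt_refPath a c hs).deriv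
  rw [this.deriv_eq, (hasDerivAt_refVelocity a c ht).deriv]

theorem continuousOn_refVelocity (a c : Config N d) : ContinuousOn (refVelocity a c) (Ici 1) :=
  fun _ ht ↦ (hasDerivAt_refVelocity a c
    (zero_lt_one.trans_le ht)).continuousAt.continuousWithinAt

theorem tendsto_refVelocity (a c : Config N d) :
    Tendsto (refVelocity a c) atTop (𝓝 a) := by
  have h1 : Tendsto (fun t : ℝ ↦ 2 / 3 * t ^ (-(1 / 3) : ℝ)) atTop (𝓝 0) :=
    ((isTame_rpow (p := -(1 / 3)) (by norm_num)).const_mul _).tendsto_zero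
  have h2 : Tendsto (fun t : ℝ ↦ a + (2 / 3 * t ^ (-(1 / 3) : ℝ)) • c) atTop
      (𝓝 (a + (0 : ℝ) • c)) := tendsto_const_nhds.add (h1.smul_const c)
  rw [zero_smul, add_zero] at h2
  exact h2

theorem absolutelyContinuous_refPath (a c : Config N d) {s t : ℝ} (hs : 1 ≤ s) (hst : s ≤ t) :
    AbsolutelyContinuousOnInterval (refPath a c) s t :=
  absolutelyContinuous_smul_add_rpow_smul a c hs hst

theorem refPath_mem {a c : Config N d} (ha : a ∈ configSpace m) (hc : c ∈ configSpace m) (t : ℝ) :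
    refPath a c t ∈ configSpace m :=
  (configSpace m).add_mem ((configSpace m).smul_mem _ ha) ((configSpace m).smul_mem _ hc)

/-- The linear part shifts by exactly −Ta, so only the t^(2/3) part leaves an error. -/
theorem exists_norm_refPath_shift_le (a c : Config N d) (T : ℝ) :
    ∃ C, 0 ≤ C ∧ ∀ t, 1 ≤ t → 1 ≤ t - T →
      ‖refPath a c (t - T) - refPath a c t + T • a‖ ≤ C * t ^ (-(1 / 3) : ℝ) := by
  obtain ⟨C, hC, h⟩ := exists_abs_rpow_shift_le (p := 2 / 3) (by norm_num) T
  refine ⟨C * ‖c‖, by positivity, fun t ht htT ↦ ?_⟩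
  have h1 : refPath a c (t - T) - refPath a c t + T • a =
      ((t - T) ^ (2 / 3 : ℝ) - t ^ (2 / 3 : ℝ)) • c := by
    simp only [refPath, sub_smul]
    abel
  rw [h1, norm_smul, Real.norm_eq_abs, mul_right_comm]
  have := h t ht htT
  rw [show (2 / 3 - 1 : ℝ) = -(1 / 3) by norm_num] at this
  exact mul_le_mul_of_nonneg_right this (norm_nonneg _)

theorem tendsto_refPath_shift (a c : Config N d) (T : ℝ) :
    Tendsto (fun t ↦ refPath a c (t + T) - refPath a c t) atTop (𝓝 (T • a)) := by
  obtain ⟨C, -, h⟩ := exists_norm_refPath_shift_le a c (-T)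
  have h1 : Tendsto (fun t : ℝ ↦ C * t ^ (-(1 / 3) : ℝ)) atTop (𝓝 0) :=
    ((isTame_rpow (p := -(1 / 3)) (by norm_num)).const_mul C).tendsto_zero
  have h2 : Tendsto (fun t ↦ refPath a c (t + T) - refPath a c t - T • a) atTop (𝓝 0) := by
    refine squeeze_zero_norm' ?_ h1
    filter_upwards [eventually_ge_atTop 1, eventually_ge_atTop (1 - T)] with t ht htT
    have := h t ht (by linarith)
    rwa [sub_neg_eq_add, neg_smul, ← sub_eq_add_neg] at this
  simpa using h2.add_const (T • a)

/-! ### Growth of finite-energy perturbations -/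

/-- Integrate ‖φ'‖ ≤ 1 + ‖φ'‖². Cauchy–Schwarz would give √t, but linear growth suffices: in the
shift estimates φ meets factors that are O(t^(−4/3)) or smaller. -/
theorem IsD012.exists_norm_le (hm : ∀ i, 0 < m i) {φ : ℝ → Config N d} (hφ : IsD012 m φ) :
    ∃ C, 0 ≤ C ∧ ∀ t, 1 ≤ t → ‖φ t‖ ≤ C * t := by
  obtain ⟨C, hC, hCn⟩ := exists_norm_sq_le (d := d) hm
  obtain ⟨hcurve, h1, hfin⟩ := hφ
  set K := ∫⁻ t in Ioi (1 : ℝ), ENNReal.ofReal (massNormSq m (deriv φ t)) with hK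
  refine ⟨1 + C * K.toReal, by positivity, fun t ht ↦ ?_⟩
  have h2 : ‖φ t‖ₑ ≤ ENNReal.ofReal (t - 1 + C * K.toReal) := by
    rcases ht.eq_or_lt with rfl | ht'
    · rw [h1]; simp
    have h3 := (hcurve t ht').1.edist_le_lintegral (left_mem_Icc.2 ht) (right_mem_Icc.2 ht) ht
    rw [h1, edist_zero_left] at h3
    refine h3.trans ?_
    calc ∫⁻ r in Ioc 1 t, ‖deriv φ r‖ₑ
        ≤ ∫⁻ r in Ioc 1 t, (1 + ENNReal.ofReal C * ENNReal.ofReal (massNormSq m (deriv φ r))) := by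
          refine lintegral_mono fun r ↦ ?_
          rw [← ENNReal.ofReal_mul hC, ← ENNReal.ofReal_one, ← ofReal_norm,
            ← ENNReal.ofReal_add zero_le_one (mul_nonneg hC (massNormSq_nonneg hm _))]
          refine ENNReal.ofReal_le_ofReal ?_
          nlinarith [hCn (deriv φ r), sq_nonneg (‖deriv φ r‖ - 1), sq_nonneg ‖deriv φ r‖]
      _ ≤ ENNReal.ofReal (t - 1) + ENNReal.ofReal C * K := by
          rw [lintegral_add_left measurable_const, setLIntegral_const, one_mul, Real.volume_Ioc,
            lintegral_const_mul' _ _ ENNReal.ofReal_ne_top]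
          gcongr
          exact lintegral_mono_set Ioc_subset_Ioi_self
      _ = _ := by
          rw [ENNReal.ofReal_add (by linarith) (by positivity), ENNReal.ofReal_mul hC,
            ENNReal.ofReal_toReal hfin.ne]
  rw [← ofReal_norm, ENNReal.ofReal_le_ofReal_iff (by
    have : 0 ≤ C * K.toReal := by positivity
    linarith)] at h2
  have : 0 ≤ C * K.toReal := by positivity
  nlinarith

end NBody

namespace NBody

variable {N d : ℕ} {m : Fin N → ℝ}

/-! ### The real-valued Lagrangian -/

/-- The Lagrangian `½‖γ'‖²_𝓜 + U(γ)` at times without collisions. -/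
noncomputable def lagrangian (m : Fin N → ℝ) (γ : ℝ → Config N d) (t : ℝ) : ℝ :=
  massNormSq m (deriv γ t) / 2 + (potential m (γ t)).toReal

theorem lagrangian_nonneg (hm : ∀ i, 0 < m i) (γ : ℝ → Config N d) (t : ℝ) :
    0 ≤ lagrangian m γ t :=
  add_nonneg (div_nonneg (massNormSq_nonneg hm _) zero_le_two) ENNReal.toReal_nonneg

theorem IsCurve.aestronglyMeasurable_lagrangian {γ : ℝ → Config N d} {a b : ℝ}
    (h : IsCurve m γ a b) (hab : a ≤ b) :
    AEStronglyMeasurable (lagrangian m γ) (volume.restrict (Icc a b)) :=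
  (((measurable_massNormSq_deriv γ).div_const 2).aemeasurable.add
    (h.aemeasurable_potential hab).ennreal_toReal).aestronglyMeasurable

theorem lagrangianAction_eq_lintegral (hm : ∀ i, 0 < m i) {γ : ℝ → Config N d} {a b : ℝ}
    (hU : ∀ᵐ t ∂(volume.restrict (Icc a b)), potential m (γ t) ≠ ∞) :
    lagrangianAction m γ a b = ∫⁻ t in Icc a b, ENNReal.ofReal (lagrangian m γ t) := by
  refine lintegral_congr_ae ?_
  filter_upwards [hU] with t ht
  rw [lagrangian, ENNReal.ofReal_add (div_nonneg (massNormSq_nonneg hm _) zero_le_two)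
    ENNReal.toReal_nonneg, ENNReal.ofReal_toReal ht]

theorem IsCurve.ae_potential_ne_top {γ : ℝ → Config N d} {a b : ℝ} (h : IsCurve m γ a b)
    (hab : a ≤ b) (hfin : lagrangianAction m γ a b ≠ ∞) :
    ∀ᵐ t ∂(volume.restrict (Icc a b)), potential m (γ t) ≠ ∞ := by
  filter_upwards [ae_lt_top' ((measurable_kinetic γ).aemeasurable.add
    (h.aemeasurable_potential hab)) hfin] with t ht
  exact (ENNReal.add_lt_top.1 ht).2.ne

theorem IsCurve.integrableOn_lagrangian (hm : ∀ i, 0 < m i) {γ : ℝ → Config N d} {a b : ℝ}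
    (h : IsCurve m γ a b) (hab : a ≤ b) (hfin : lagrangianAction m γ a b ≠ ∞) :
    IntegrableOn (lagrangian m γ) (Icc a b) := by
  refine ⟨h.aestronglyMeasurable_lagrangian hab, ?_⟩
  rw [hasFiniteIntegral_iff_ofReal (ae_of_all _ (lagrangian_nonneg hm γ)),
    ← lagrangianAction_eq_lintegral hm (h.ae_potential_ne_top hab hfin)]
  exact hfin.lt_top

theorem IsCurve.integral_lagrangian (hm : ∀ i, 0 < m i) {γ : ℝ → Config N d} {a b : ℝ}
    (h : IsCurve m γ a b) (hab : a ≤ b) (hfin : lagrangianAction m γ a b ≠ ∞) :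
    ∫ t in a..b, lagrangian m γ t = (lagrangianAction m γ a b).toReal := by
  rw [lagrangianAction_eq_lintegral hm (h.ae_potential_ne_top hab hfin),
    intervalIntegral.integral_of_le hab, ← integral_Icc_eq_integral_Ioc,
    integral_eq_lintegral_of_nonneg_ae (ae_of_all _ (lagrangian_nonneg hm γ))
      (h.aestronglyMeasurable_lagrangian hab)]

theorem lagrangianAction_ne_top (hm : ∀ i, 0 < m i) {γ : ℝ → Config N d} {a b : ℝ}
    (hU : ∀ᵐ t ∂(volume.restrict (Icc a b)), potential m (γ t) ≠ ∞)
    (hint : IntegrableOn (lagrangian m γ) (Icc a b)) : lagrangianAction m γ a b ≠ ∞ := by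
  rw [lagrangianAction_eq_lintegral hm hU]
  have := hint.2
  rw [hasFiniteIntegral_iff_ofReal (ae_of_all _ (lagrangian_nonneg hm γ))] at this
  exact this.ne

/-! ### The renormalized action on compact intervals -/

/-- The motion with perturbation `ψ`. -/
noncomputable def trajectory (a c x₀ : Config N d) (ψ : ℝ → Config N d) (t : ℝ) : Config N d :=
  ψ t + refPath a c t + x₀

theorem IsCurve.trajectory {a c x₀ : Config N d} {ψ : ℝ → Config N d} (ha : a ∈ configSpace m)
    (hc : c ∈ configSpace m) (hx₀ : x₀ ∈ configSpace m) {s t : ℝ} (hs : 1 ≤ s) (hst : s ≤ t)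
    (h : IsCurve m ψ s t) : IsCurve m (trajectory a c x₀ ψ) s t :=
  ⟨(h.1.fun_add (absolutelyContinuous_refPath a c hs hst)).fun_add
    (contDiffOn_const.absolutelyContinuousOnInterval),
    fun r hr ↦ (configSpace m).add_mem ((configSpace m).add_mem (h.2 r hr)
      (refPath_mem ha hc r)) hx₀⟩

theorem deriv_trajectory (a c x₀ : Config N d) {ψ : ℝ → Config N d} {t : ℝ} (ht : 0 < t)
    (h : DifferentiableAt ℝ ψ t) :
    deriv (trajectory a c x₀ ψ) t = deriv ψ t + refVelocity a c t :=
  ((h.hasDerivAt.add (hasDerivAt_refPath a c ht)).add_const x₀).deriv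

/-- The pairing of the reference velocity with the perturbation. -/
noncomputable def boundaryTerm (m : Fin N → ℝ) (a c : Config N d) (ψ : ℝ → Config N d) (t : ℝ) :
    ℝ :=
  massInner m (refVelocity a c t) (ψ t)

theorem boundaryTerm_eq (a c : Config N d) (ψ : ℝ → Config N d) :
    boundaryTerm m a c ψ = fun t ↦ massInnerCLM m a (ψ t) +
      (2 / 3 * t ^ (-(1 / 3) : ℝ)) * massInnerCLM m c (ψ t) := by
  funext t
  simp only [boundaryTerm, refVelocity, massInner_add_left, massInner_smul_left,
    massInnerCLM_apply]

theorem absolutelyContinuous_boundaryTerm (a c : Config N d) {ψ : ℝ → Config N d} {R : ℝ}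
    (hR : 1 ≤ R) (h : AbsolutelyContinuousOnInterval ψ 1 R) :
    AbsolutelyContinuousOnInterval (boundaryTerm m a c ψ) 1 R := by
  rw [boundaryTerm_eq]
  refine (h.clm_comp _).fun_add (AbsolutelyContinuousOnInterval.fun_mul ?_ (h.clm_comp _))
  refine ContDiffOn.absolutelyContinuousOnInterval fun r hr ↦ ?_
  rw [uIcc_of_le hR] at hr
  have h0 : r ≠ 0 := by linarith [hr.1]
  exact (contDiffAt_const.mul (Real.contDiffAt_rpow_const_of_ne h0)).contDiffWithinAt

theorem deriv_boundaryTerm (a c : Config N d) {ψ : ℝ → Config N d} {t : ℝ} (ht : 0 < t)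
    (h : DifferentiableAt ℝ ψ t) : deriv (boundaryTerm m a c ψ) t =
      massInner m (deriv (deriv (refPath a c)) t) (ψ t) +
        massInner m (refVelocity a c t) (deriv ψ t) := by
  have h1 : HasDerivAt (fun t : ℝ ↦ t ^ (-(1 / 3) : ℝ))
      (-(1 / 3) * t ^ (-(1 / 3) - 1 : ℝ)) t := Real.hasDerivAt_rpow_const (Or.inl ht.ne')
  have h2 : ∀ v : Config N d, HasDerivAt (fun s ↦ massInnerCLM m v (ψ s))
      (massInnerCLM m v (deriv ψ t)) t := fun v ↦
    (massInnerCLM m v).hasFDerivAt.comp_hasDerivAt t h.hasDerivAt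
  rw [boundaryTerm_eq, ((h2 a).fun_add ((h1.const_mul (2 / 3)).fun_mul (h2 c))).deriv,
    deriv_deriv_refPath a c ht]
  simp only [refVelocity, massInner_add_left, massInner_smul_left, massInnerCLM_apply]
  rw [show (-(1 / 3) - 1 : ℝ) = -(4 / 3) by norm_num]
  ring

/-- The renormalized Lagrangian is the Lagrangian up to a reference term and a total derivative. -/
theorem ae_renormLagrangian_eq (a c x₀ : Config N d) (P : ℝ → ℝ) {ψ : ℝ → Config N d} {R : ℝ}
    (hR : 1 ≤ R) (h : IsCurve m ψ 1 R) :
    ∀ᵐ t, t ∈ Icc 1 R → renormLagrangian m a c x₀ P ψ t = lagrangian m (trajectory a c x₀ ψ) t -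
      (massNormSq m (refVelocity a c t) / 2 + P t) - deriv (boundaryTerm m a c ψ) t := by
  filter_upwards [h.ae_differentiableAt hR] with t ht hmem
  have h0 : 0 < t := by linarith [hmem.1]
  rw [lagrangian, deriv_trajectory a c x₀ h0 (ht hmem), deriv_boundaryTerm a c h0 (ht hmem),
    massNormSq_add, massInner_comm (deriv ψ t), renormLagrangian, trajectory]
  ring

theorem continuousOn_referenceTerm (a c : Config N d) {P : ℝ → ℝ} (hP : ContinuousOn P (Ici 1)) :
    ContinuousOn (fun t ↦ massNormSq m (refVelocity a c t) / 2 + P t) (Ici 1) :=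
  ((continuous_massNormSq.comp_continuousOn (continuousOn_refVelocity a c)).div_const 2).add hP

theorem intervalIntegrable_referenceTerm (a c : Config N d) {P : ℝ → ℝ}
    (hP : ContinuousOn P (Ici 1)) {s t : ℝ} (hs : 1 ≤ s) (ht : 1 ≤ t) :
    IntervalIntegrable (fun t ↦ massNormSq m (refVelocity a c t) / 2 + P t) volume s t :=
  ((continuousOn_referenceTerm a c hP).mono fun _ hr ↦ (le_inf hs ht).trans hr.1).intervalIntegrable

theorem integrableOn_renormLagrangian_iff (a c x₀ : Config N d) {P : ℝ → ℝ}
    (hP : ContinuousOn P (Ici 1)) {ψ : ℝ → Config N d} {R : ℝ} (hR : 1 ≤ R)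
    (h : IsCurve m ψ 1 R) :
    IntegrableOn (renormLagrangian m a c x₀ P ψ) (Icc 1 R) ↔
      IntegrableOn (lagrangian m (trajectory a c x₀ ψ)) (Icc 1 R) := by
  have h1 : IntegrableOn (fun t ↦ massNormSq m (refVelocity a c t) / 2 + P t) (Icc 1 R) :=
    ((continuousOn_referenceTerm a c hP).mono Icc_subset_Ici_self).integrableOn_Icc
  have h2 : IntegrableOn (deriv (boundaryTerm m a c ψ)) (Icc 1 R) := by
    have := (absolutelyContinuous_boundaryTerm (m := m) a c hR h.1).intervalIntegrable_deriv
    rwa [intervalIntegrable_iff_integrableOn_Icc_of_le hR] at this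
  have hae := (ae_restrict_iff' measurableSet_Icc).2 (ae_renormLagrangian_eq a c x₀ P hR h)
  constructor
  · intro hL
    refine ((hL.add h1).add h2).congr ?_
    filter_upwards [hae] with t ht
    simp only [Pi.add_apply, ht]
    ring
  · intro hL
    refine ((hL.sub h1).sub h2).congr ?_
    filter_upwards [hae] with t ht
    simp only [Pi.sub_apply, ht]

/-- Integration by parts; the boundary term at time 1 drops out because ψ(1) = 0. -/
theorem integral_renormLagrangian (a c x₀ : Config N d) {P : ℝ → ℝ}
    (hP : ContinuousOn P (Ici 1)) {ψ : ℝ → Config N d} {R : ℝ} (hR : 1 ≤ R)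
    (h : IsCurve m ψ 1 R) (h0 : ψ 1 = 0)
    (hint : IntegrableOn (lagrangian m (trajectory a c x₀ ψ)) (Icc 1 R)) :
    ∫ t in (1 : ℝ)..R, renormLagrangian m a c x₀ P ψ t =
      (∫ t in (1 : ℝ)..R, lagrangian m (trajectory a c x₀ ψ) t) -
      (∫ t in (1 : ℝ)..R, (massNormSq m (refVelocity a c t) / 2 + P t)) -
      boundaryTerm m a c ψ R := by
  have hAC := absolutelyContinuous_boundaryTerm (m := m) a c hR h.1
  have hint' : IntervalIntegrable (lagrangian m (trajectory a c x₀ ψ)) volume 1 R :=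
    (intervalIntegrable_iff_integrableOn_Icc_of_le hR).2 hint
  have hb1 : boundaryTerm m a c ψ 1 = 0 := by
    rw [boundaryTerm, h0, ← massInnerCLM_apply, map_zero]
  have hFTC := hAC.integral_deriv_eq_sub
  rw [hb1, sub_zero] at hFTC
  rw [← hFTC, ← intervalIntegral.integral_sub hint'
    (intervalIntegrable_referenceTerm a c hP le_rfl hR), ← intervalIntegral.integral_sub
    (hint'.sub (intervalIntegrable_referenceTerm a c hP le_rfl hR)) hAC.intervalIntegrable_deriv]
  refine intervalIntegral.integral_congr_ae ?_
  filter_upwards [ae_renormLagrangian_eq a c x₀ P hR h] with t ht hmem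
  rw [uIoc_of_le hR] at hmem
  exact ht (Ioc_subset_Icc_self hmem)

/-! ### Time shifts of the tail -/

theorem IsD012.integrableOn_massNormSq (hm : ∀ i, 0 < m i) {φ : ℝ → Config N d}
    (hφ : IsD012 m φ) : IntegrableOn (fun t ↦ massNormSq m (deriv φ t)) (Ioi 1) := by
  refine ⟨(measurable_massNormSq_deriv φ).aestronglyMeasurable, ?_⟩
  rw [hasFiniteIntegral_iff_ofReal (ae_of_all _ fun t ↦ massNormSq_nonneg hm _)]
  exact hφ.2.2

theorem IsD012.continuousOn {φ : ℝ → Config N d} (hφ : IsD012 m φ) : ContinuousOn φ (Ici 1) := by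
  intro t (ht : 1 ≤ t)
  have h1 := (hφ.1 (t + 1) (by linarith)).continuousOn (by linarith) t ⟨ht, by linarith⟩
  refine h1.mono_of_mem_nhdsWithin ?_
  filter_upwards [self_mem_nhdsWithin, mem_nhdsWithin_of_mem_nhds (Iio_mem_nhds
    (show t < t + 1 by linarith))] with s h2 h3 using ⟨h2, h3.le⟩

theorem IsD012.ae_differentiableAt {φ : ℝ → Config N d} (hφ : IsD012 m φ) :
    ∀ᵐ t, 1 < t → DifferentiableAt ℝ φ t := by
  have h1 : ∀ n : ℕ, ∀ᵐ t, t ∈ Icc (1 : ℝ) (n + 2) → DifferentiableAt ℝ φ t := fun n ↦ by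
    have hn : (1 : ℝ) < n + 2 := by
      have : (0 : ℝ) ≤ n := n.cast_nonneg
      linarith
    exact (hφ.1 _ hn).ae_differentiableAt hn.le
  filter_upwards [ae_all_iff.2 h1] with t ht h1t
  obtain ⟨n, hn⟩ := exists_nat_ge t
  exact ht n ⟨h1t.le, by linarith⟩

section Tail

variable {a c x₀ : Config N d} {φ ψ : ℝ → Config N d} {T R : ℝ}

theorem IsD012.ae_deriv_shift (hφ : IsD012 m φ) (hR : 1 ≤ R) (hRT : 1 ≤ R - T)
    (hψ : ∀ t, R ≤ t → ψ t = φ (t - T) + (refPath a c (t - T) - refPath a c t)) :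
    ∀ᵐ t ∂(volume.restrict (Ioi R)), deriv ψ t = deriv φ (t - T) +
      (2 / 3 * ((t - T) ^ (-(1 / 3) : ℝ) - t ^ (-(1 / 3) : ℝ))) • c := by
  rw [ae_restrict_iff' measurableSet_Ioi]
  filter_upwards [(measurePreserving_sub_right volume T).quasiMeasurePreserving.ae
    hφ.ae_differentiableAt] with t h1 (ht : R < t)
  have h2 := (h1 (by linarith)).hasDerivAt.comp_sub_const t T
  have h3 := (hasDerivAt_refPath a c (show 0 < t - T by linarith)).comp_sub_const t T
  have h4 := hasDerivAt_refPath a c (show 0 < t by linarith)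
  have h5 := (h2.add (h3.sub h4)).congr_of_eventuallyEq (f₁ := ψ) (by
    filter_upwards [lt_mem_nhds ht] with s hs using hψ s hs.le)
  rw [h5.deriv]
  simp only [refVelocity, mul_sub, sub_smul]
  abel

/-- The velocity `a` cancels in r₀'(t − T) − r₀'(t), which leaves O(t^(−4/3)), a square-integrable
correction to φ'(t − T). -/
theorem IsD012.integrableOn_massNormSq_shift (hm : ∀ i, 0 < m i) (hφ : IsD012 m φ) (hR : 1 ≤ R)
    (hRT : 1 ≤ R - T)
    (hψ : ∀ t, R ≤ t → ψ t = φ (t - T) + (refPath a c (t - T) - refPath a c t)) :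
    IntegrableOn (fun t ↦ massNormSq m (deriv ψ t)) (Ioi R) := by
  obtain ⟨C, hC, hb⟩ := exists_abs_rpow_shift_le (p := -(1 / 3)) (by norm_num) T
  have h1 := integrableOn_comp_sub (hφ.integrableOn_massNormSq hm) hRT
  have h2 := (integrableOn_rpow_of_le (p := -(8 / 3)) (by norm_num) hR).const_mul
    (2 * ((2 / 3 * C) ^ 2 * massNormSq m c))
  refine ((h1.const_mul 2).add h2).mono' (measurable_massNormSq_deriv ψ).aestronglyMeasurable ?_
  filter_upwards [hφ.ae_deriv_shift hR hRT hψ, ae_restrict_mem measurableSet_Ioi]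
    with t ht (hRt : R < t)
  rw [Real.norm_of_nonneg (massNormSq_nonneg hm _), ht]
  refine (massNormSq_add_le hm _ _).trans (add_le_add le_rfl ?_)
  have h0 : 0 < t := by linarith
  have h3 := hb t (by linarith) (by linarith)
  rw [massNormSq_smul, mul_pow, ← sq_abs (_ - _)]
  have h4 : |(t - T) ^ (-(1 / 3) : ℝ) - t ^ (-(1 / 3) : ℝ)| ^ 2 ≤ C ^ 2 * t ^ (-(8 / 3) : ℝ) := by
    refine (pow_le_pow_left₀ (abs_nonneg _) h3 2).trans_eq ?_
    rw [mul_pow, ← Real.rpow_mul_natCast h0.le]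
    norm_num
  have h5 := massNormSq_nonneg hm c
  calc _ ≤ 2 * ((2 / 3) ^ 2 * (C ^ 2 * t ^ (-(8 / 3) : ℝ)) * massNormSq m c) := by gcongr
    _ = _ := by ring

theorem continuousOn_refPath (a c : Config N d) : ContinuousOn (refPath a c) (Ici 1) :=
  fun _ ht ↦ (hasDerivAt_refPath a c (zero_lt_one.trans_le ht)).continuousAt.continuousWithinAt

theorem continuousOn_massInner {f : ℝ → Config N d} {s : Set ℝ} (hf : ContinuousOn f s)
    (c : Config N d) : ContinuousOn (fun t ↦ massInner m c (f t)) s := by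
  simp only [← massInnerCLM_apply]
  exact (massInnerCLM m c).continuous.comp_continuousOn hf

theorem IsD012.integrableOn_rpow_shift_mul (hm : ∀ i, 0 < m i) (hφ : IsD012 m φ)
    (c : Config N d) (hR : 1 ≤ R) (hRT : 1 ≤ R - T) :
    IntegrableOn (fun t ↦ ((t - T) ^ (-(4 / 3) : ℝ) - t ^ (-(4 / 3) : ℝ)) *
      massInner m c (φ (t - T))) (Ioi R) := by
  obtain ⟨C, hC, hb⟩ := exists_abs_rpow_shift_le (p := -(4 / 3)) (by norm_num) T
  obtain ⟨D, hD, hg⟩ := hφ.exists_norm_le hm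
  have hM := sum_mass_nonneg hm
  have hpow : ContinuousOn (fun t : ℝ ↦ t ^ (-(4 / 3) : ℝ)) (Ici R) :=
    (continuousOn_rpow_Ici _).mono (Ici_subset_Ici.2 hR)
  refine ((integrableOn_rpow_of_le (p := -(4 / 3)) (by norm_num) hR).const_mul
    (C * ((∑ i, m i) * (‖c‖ * (D * (1 + |T|)))))).mono' ?_ ?_
  · exact ((((continuousOn_comp_sub (continuousOn_rpow_Ici _) hRT).sub hpow).mul
      (continuousOn_massInner (continuousOn_comp_sub hφ.continuousOn hRT) c)).mono
      Ioi_subset_Ici_self).aestronglyMeasurable measurableSet_Ioi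
  · refine (ae_restrict_iff' measurableSet_Ioi).2 (ae_of_all _ fun t (ht : R < t) ↦ ?_)
    have h0 : 0 < t := by linarith
    have h2 : ‖φ (t - T)‖ ≤ D * ((1 + |T|) * t) := by
      refine (hg (t - T) (by linarith)).trans (mul_le_mul_of_nonneg_left ?_ hD)
      nlinarith [neg_abs_le T, abs_nonneg T]
    have h3 : |massInner m c (φ (t - T))| ≤ (∑ i, m i) * (‖c‖ * (D * ((1 + |T|) * t))) :=
      (abs_massInner_le hm _ _).trans
        (mul_le_mul_of_nonneg_left (mul_le_mul_of_nonneg_left h2 (norm_nonneg _)) hM)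
    rw [Real.norm_eq_abs, abs_mul]
    calc _ ≤ C * t ^ (-(4 / 3) - 1 : ℝ) * ((∑ i, m i) * (‖c‖ * (D * ((1 + |T|) * t)))) :=
          mul_le_mul (hb t (by linarith) (by linarith)) h3 (abs_nonneg _) (by positivity)
      _ = _ := by
          rw [Real.rpow_sub h0, Real.rpow_one]
          field_simp

theorem exists_norm_refPath_sub_le (a c : Config N d) (T : ℝ) :
    ∃ E, ∀ t, 1 ≤ t → 1 ≤ t - T → ‖refPath a c (t - T) - refPath a c t‖ ≤ E := by
  obtain ⟨E, hE, hq⟩ := exists_norm_refPath_shift_le a c T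
  refine ⟨E + ‖T • a‖, fun t ht htT ↦ ?_⟩
  have h4 := hq t ht htT
  have h5 : t ^ (-(1 / 3) : ℝ) ≤ 1 := Real.rpow_le_one_of_one_le_of_nonpos ht (by norm_num)
  have h6 := norm_sub_le (refPath a c (t - T) - refPath a c t + T • a) (T • a)
  rw [add_sub_cancel_right] at h6
  linarith [mul_le_mul_of_nonneg_left h5 hE]

theorem integrableOn_rpow_mul_refPath_sub (hm : ∀ i, 0 < m i) (a c : Config N d) (hR : 1 ≤ R)
    (hRT : 1 ≤ R - T) :
    IntegrableOn (fun t ↦ t ^ (-(4 / 3) : ℝ) *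
      massInner m c (refPath a c (t - T) - refPath a c t)) (Ioi R) := by
  obtain ⟨E, hE⟩ := exists_norm_refPath_sub_le a c T
  have hM := sum_mass_nonneg hm
  have hpow : ContinuousOn (fun t : ℝ ↦ t ^ (-(4 / 3) : ℝ)) (Ici R) :=
    (continuousOn_rpow_Ici _).mono (Ici_subset_Ici.2 hR)
  have hrc := continuousOn_refPath a c
  refine ((integrableOn_rpow_of_le (p := -(4 / 3)) (by norm_num) hR).const_mul
    ((∑ i, m i) * (‖c‖ * E))).mono' ?_ ?_
  · exact ((hpow.mul (continuousOn_massInner ((continuousOn_comp_sub hrc hRT).sub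
      (hrc.mono (Ici_subset_Ici.2 hR))) c)).mono Ioi_subset_Ici_self).aestronglyMeasurable
      measurableSet_Ioi
  · refine (ae_restrict_iff' measurableSet_Ioi).2 (ae_of_all _ fun t (ht : R < t) ↦ ?_)
    have h0 : 0 < t := by linarith
    rw [Real.norm_eq_abs, abs_mul, abs_of_nonneg (Real.rpow_nonneg h0.le _), mul_comm]
    exact mul_le_mul_of_nonneg_right ((abs_massInner_le hm _ _).trans
      (mul_le_mul_of_nonneg_left (mul_le_mul_of_nonneg_left
        (hE t (by linarith) (by linarith)) (norm_nonneg _)) hM)) (Real.rpow_nonneg h0.le _)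

/-- Both paths are at the same point, ψ at time t and φ at time t − T, so the potentials cancel and
no estimate of `U` is needed. What remains is kinetic energy, the shift of `P`, and pairings with
r₀'' = −(2/9) t^(−4/3) c. -/
theorem IsD012.integrableOn_renormLagrangian_shift (hm : ∀ i, 0 < m i) (hφ : IsD012 m φ)
    {P : ℝ → ℝ} (hP : IsTame P) (hL : IntegrableOn (renormLagrangian m a c x₀ P φ) (Ioi 1))
    (hR : 1 ≤ R) (hRT : 1 ≤ R - T)
    (hψ : ∀ t, R ≤ t → ψ t = φ (t - T) + (refPath a c (t - T) - refPath a c t)) :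
    IntegrableOn (renormLagrangian m a c x₀ P ψ) (Ioi R) := by
  have hL' := integrableOn_comp_sub hL hRT
  have hφ' := integrableOn_comp_sub (hφ.integrableOn_massNormSq hm) hRT
  have hψ' := hφ.integrableOn_massNormSq_shift hm hR hRT hψ
  have hP' := hP.integrableOn_shift T R hR hRT
  have h1 := hφ.integrableOn_rpow_shift_mul hm c hR hRT
  have h2 := integrableOn_rpow_mul_refPath_sub (T := T) hm a c hR hRT
  refine ((((hL'.add ((hψ'.sub hφ').div_const 2)).add hP').sub (h1.const_mul (2 / 9))).add
    (h2.const_mul (2 / 9))).congr ?_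
  filter_upwards [ae_restrict_mem measurableSet_Ioi] with t (ht : R < t)
  have hy : ψ t + refPath a c t + x₀ = φ (t - T) + refPath a c (t - T) + x₀ := by
    rw [hψ t ht.le]
    abel
  simp only [Pi.add_apply, Pi.sub_apply, renormLagrangian]
  rw [hy, deriv_deriv_refPath a c (show 0 < t by linarith),
    deriv_deriv_refPath a c (show 0 < t - T by linarith), hψ t ht.le, massInner_smul_left,
    massInner_smul_left, massInner_add_right]
  ring

end Tail

end NBody

namespace NBody

variable {N d : ℕ} {m : Fin N → ℝ}

/-! ### The reference path lies in the configuration space -/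

/-- Sum over the clusters one at a time: each block is zero or a multiple of a configuration centred
within its cluster. -/
theorem HyperbolicParabolicSetting.mem_configSpace {a c : Config N d}
    (h : HyperbolicParabolicSetting m a c) : c ∈ configSpace m := by
  classical
  obtain ⟨-, -, -, b, hb⟩ := h
  change ∑ i, m i • c i = 0
  rw [← Finset.sum_fiberwise_of_maps_to (s := Finset.univ) (t := Finset.univ.image a) (g := a)
    (fun i _ ↦ Finset.mem_image_of_mem a (Finset.mem_univ i))]
  refine Finset.sum_eq_zero fun v hv ↦ ?_
  obtain ⟨i, -, rfl⟩ := Finset.mem_image.1 hv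
  have hK : Finset.univ.filter (fun j ↦ a j = a i) = cluster a i := by
    ext j
    simp [cluster]
  have hmem : ∀ j ∈ cluster a i, cluster a j = cluster a i := fun j hj ↦ by
    have hj' : a j = a i := by simpa [cluster] using hj
    simp only [cluster, hj']
  rw [hK]
  have hpos : 0 < (cluster a i).card := Finset.card_pos.2 ⟨i, by simp [cluster]⟩
  rcases Nat.lt_or_ge (cluster a i).card 2 with h1 | h2
  · refine Finset.sum_eq_zero fun j hj ↦ ?_
    rw [(hb j).1 (by rw [hmem j hj]; lia), smul_zero]
  · have h3 : ∀ j ∈ cluster a i, m j • c j = betaFactor m (cluster a i) b • (m j • b j) :=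
      fun j hj ↦ by
        rw [((hb j).2 (by rwa [hmem j hj])).2, hmem j hj, smul_comm]
    rw [Finset.sum_congr rfl h3, ← Finset.smul_sum, ((hb i).2 h2).1.1.1, smul_zero]

theorem mem_configSpace_of_setting {a c : Config N d}
    (h : HyperbolicSetting m a c ∨ ParabolicSetting m a c ∨ HyperbolicParabolicSetting m a c) :
    a ∈ configSpace m ∧ c ∈ configSpace m := by
  rcases h with ⟨ha, -, rfl⟩ | ⟨rfl, b, hb, rfl⟩ | h
  · exact ⟨ha, Submodule.zero_mem _⟩
  · exact ⟨Submodule.zero_mem _, Submodule.smul_mem _ _ hb.1.1⟩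
  · exact ⟨h.1, h.mem_configSpace⟩

/-! ### Free-time minimality -/

/-- Replace `γ` on `[s, u + T]` by a time shift of `σ`, and run `γ` with the delay `T` afterwards. -/
noncomputable def splice (γ σ : ℝ → Config N d) (s s' u T : ℝ) (t : ℝ) : Config N d :=
  if t ≤ s then γ t else if t ≤ u + T then σ (t - (s - s')) else γ (t - T)

/-! ### Splicing a competitor into the motion -/

section Splice

variable {γ σ : ℝ → Config N d} {s u s' u' T : ℝ}

theorem splice_eqOn_left (s₀ : ℝ) : EqOn γ (splice γ σ s s' u T) (Icc s₀ s) := fun t ht ↦ by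
  simp [splice, ht.2]

theorem splice_eqOn_middle (h : σ s' = γ s) :
    EqOn (fun t ↦ σ (t - (s - s'))) (splice γ σ s s' u T) (Icc s (u + T)) := fun t ht ↦ by
  rcases ht.1.eq_or_lt with rfl | hlt
  · simp [splice, h]
  · simp [splice, hlt.not_ge, ht.2]

theorem splice_eq_right (hsu : s < u + T) (hT : u + T - (s - s') = u') (h : σ u' = γ u) {t : ℝ}
    (ht : u + T ≤ t) : splice γ σ s s' u T t = γ (t - T) := by
  rcases ht.eq_or_lt with rfl | hlt
  · simp [splice, hsu.not_ge, hT, h]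
  · simp [splice, hlt.not_ge, (hsu.trans hlt).not_ge]

theorem isCurve_splice (hγ : ∀ v w, 1 ≤ v → v ≤ w → IsCurve m γ v w) (hs : 1 ≤ s) (hsu : s < u)
    (hsu' : s' < u') (hσ : IsCurve m σ s' u') (h : σ s' = γ s) (h' : σ u' = γ u)
    (hT : T = u' - s' - (u - s)) {R : ℝ} (hR : u + T ≤ R) :
    IsCurve m (splice γ σ s s' u T) 1 R ∧
      lagrangianAction m (splice γ σ s s' u T) 1 R = lagrangianAction m γ 1 s +
        lagrangianAction m σ s' u' + lagrangianAction m γ u (R - T) := by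
  have h1 : s < u + T := by rw [hT]; linarith
  have e1 : s' + (s - s') = s := by ring
  have e2 : u' + (s - s') = u + T := by rw [hT]; ring
  have hmid := hσ.comp_sub hsu'.le (s - s')
  have hmidA := lagrangianAction_comp_sub (m := m) σ s' u' (s - s')
  rw [e1, e2] at hmid hmidA
  have htail := (hγ u (R - T) (hs.trans hsu.le) (by linarith)).comp_sub (by linarith) T
  have htailA := lagrangianAction_comp_sub (m := m) γ u (R - T) T
  rw [sub_add_cancel] at htail htailA
  have heq : EqOn (fun t ↦ γ (t - T)) (splice γ σ s s' u T) (Icc (u + T) R) := fun t ht ↦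
    (splice_eq_right h1 (by rw [hT]; ring) h' ht.1).symm
  refine ⟨((hγ 1 s le_rfl hs).congr hs (splice_eqOn_left 1)).union hs (h1.le.trans hR)
    ((hmid.congr h1.le (splice_eqOn_middle h)).union h1.le hR (htail.congr hR heq)), ?_⟩
  rw [lagrangianAction_union _ (hs.trans h1.le) hR, lagrangianAction_union _ hs h1.le,
    ← lagrangianAction_congr (splice_eqOn_left 1), ← lagrangianAction_congr (splice_eqOn_middle h),
    ← lagrangianAction_congr heq, hmidA, htailA]

end Splice

theorem ae_restrict_Ioi_of_Icc {p : ℝ → Prop} {R₀ : ℝ}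
    (h : ∀ R, R₀ ≤ R → ∀ᵐ t ∂(volume.restrict (Icc 1 R)), p t) :
    ∀ᵐ t ∂(volume.restrict (Ioi (1 : ℝ))), p t := by
  have hU : Ioi (1 : ℝ) ⊆ ⋃ n : ℕ, Icc 1 (R₀ + n) := fun t (ht : 1 < t) ↦ by
    obtain ⟨n, hn⟩ := exists_nat_ge (t - R₀)
    exact mem_iUnion.2 ⟨n, ht.le, by linarith⟩
  refine ae_restrict_of_ae_restrict_of_subset hU ?_
  rw [ae_restrict_iUnion_iff]
  exact fun n ↦ h _ (by linarith [(n.cast_nonneg : (0 : ℝ) ≤ n)])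

/-- The velocity changes by O(R^(−4/3)) while φ grows at most linearly. -/
theorem IsD012.tendsto_massInner_refVelocity_sub (hm : ∀ i, 0 < m i) {φ : ℝ → Config N d}
    (hφ : IsD012 m φ) (a c : Config N d) (T : ℝ) :
    Tendsto (fun R ↦ massInner m (refVelocity a c (R + T) - refVelocity a c R) (φ R))
      atTop (𝓝 0) := by
  obtain ⟨C, hC, hb⟩ := exists_abs_rpow_shift_le (p := -(1 / 3)) (by norm_num) (-T)
  obtain ⟨E, hE, hg⟩ := hφ.exists_norm_le hm
  have hM := sum_mass_nonneg hm
  refine squeeze_zero_norm' ?_ ((isTame_rpow (p := -(1 / 3)) (by norm_num)).const_mul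
    (2 / 3 * C * ((∑ i, m i) * (‖c‖ * E)))).tendsto_zero
  filter_upwards [eventually_ge_atTop 1, eventually_ge_atTop (1 - T)] with R hR hRT
  have h0 : 0 < R := by linarith
  have h5 : refVelocity a c (R + T) - refVelocity a c R =
      (2 / 3 * ((R - -T) ^ (-(1 / 3) : ℝ) - R ^ (-(1 / 3) : ℝ))) • c := by
    simp only [refVelocity, mul_sub, sub_smul, sub_neg_eq_add]
    abel
  have h6 : |massInner m c (φ R)| ≤ (∑ i, m i) * (‖c‖ * (E * R)) :=
    (abs_massInner_le hm _ _).trans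
      (mul_le_mul_of_nonneg_left (mul_le_mul_of_nonneg_left (hg R hR) (norm_nonneg _)) hM)
  rw [h5, massInner_smul_left, Real.norm_eq_abs, abs_mul, abs_mul,
    abs_of_pos (show (0 : ℝ) < 2 / 3 by norm_num)]
  calc _ ≤ 2 / 3 * (C * R ^ (-(1 / 3) - 1 : ℝ)) * ((∑ i, m i) * (‖c‖ * (E * R))) :=
        mul_le_mul (mul_le_mul_of_nonneg_left (hb R hR (by linarith)) (by norm_num)) h6
          (abs_nonneg _) (by positivity)
    _ = _ := by
        rw [Real.rpow_sub h0, Real.rpow_one]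
        field_simp

theorem tendsto_referenceTerm (a c : Config N d) {P : ℝ → ℝ} (hP : IsTame P) :
    Tendsto (fun t ↦ massNormSq m (refVelocity a c t) / 2 + P t) atTop
      (𝓝 (massNormSq m a / 2)) := by
  have h1 := (continuous_massNormSq (m := m)).continuousAt.tendsto.comp (tendsto_refVelocity a c)
  have h2 := (h1.div_const 2).add hP.tendsto_zero
  rwa [add_zero] at h2

theorem tendsto_massInner {u v : ℝ → Config N d} {p q : Config N d}
    (hu : Tendsto u atTop (𝓝 p)) (hv : Tendsto v atTop (𝓝 q)) :
    Tendsto (fun t ↦ massInner m (u t) (v t)) atTop (𝓝 (massInner m p q)) := by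
  unfold massInner
  exact tendsto_finsetSum _ fun i _ ↦
    ((tendsto_pi_nhds.1 hu i).inner (tendsto_pi_nhds.1 hv i)).const_mul (m i)

theorem tendsto_massInner_refVelocity_shift (a c : Config N d) (T : ℝ) :
    Tendsto (fun R ↦ massInner m (refVelocity a c (R + T))
      (refPath a c (R + T) - refPath a c R)) atTop (𝓝 (massInner m a (T • a))) :=
  tendsto_massInner
    ((tendsto_refVelocity a c).comp (tendsto_atTop_add_const_right _ T tendsto_id))
    (tendsto_refPath_shift a c T)

/-- With h = ‖a‖²/2, the window of reference terms gives −hT and the pairing of r₀'(R + T) with r₀(R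
+ T) − r₀(R) gives +2hT. The pairing of φ(R) with the change of velocity vanishes in the limit. -/
theorem tendsto_renormAction_difference {a c : Config N d} {P : ℝ → ℝ} (hm : ∀ i, 0 < m i)
    (hP : IsTame P) {φ : ℝ → Config N d} (hφ : IsD012 m φ) (T D : ℝ) :
    Tendsto (fun R ↦ D - (∫ t in R..(R + T), (massNormSq m (refVelocity a c t) / 2 + P t)) -
      massInner m (refVelocity a c (R + T)) (φ R + (refPath a c R - refPath a c (R + T))) +
      massInner m (refVelocity a c R) (φ R)) atTop (𝓝 (D + T * (massNormSq m a / 2))) := by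
  have h1 := tendsto_referenceTerm (m := m) a c hP
  have h2 := tendsto_integral_window (continuousOn_referenceTerm (m := m) a c hP.continuousOn) h1 T
  have h3 := tendsto_massInner_refVelocity_shift (m := m) a c T
  have h4 := hφ.tendsto_massInner_refVelocity_sub hm a c T
  have h5 := ((h2.const_sub D).add h3).sub h4
  have h6 : D - T * (massNormSq m a / 2) + massInner m a (T • a) - 0 =
      D + T * (massNormSq m a / 2) := by
    rw [massInner_smul_right, massNormSq]
    ring
  rw [h6] at h5
  refine h5.congr fun R ↦ ?_
  simp only [massInner_add_right, massInner_sub_right, massInner_sub_left]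
  ring

theorem isFreeTimeMinimizer_trajectory (hm : ∀ i, 0 < m i) {a c x₀ : Config N d}
    (ha : a ∈ configSpace m) (hc : c ∈ configSpace m) (hx₀ : x₀ ∈ configSpace m) {P : ℝ → ℝ}
    (hP : IsTame P) {φ : ℝ → Config N d} (hφ : MinimizesRenormAction m a c x₀ P φ) {h : ℝ≥0}
    (hh : (h : ℝ) = massNormSq m a / 2) :
    IsFreeTimeMinimizer m h (Ici 1) (trajectory a c x₀ φ) := by
  obtain ⟨hD, hfinite, hmin⟩ := hφ
  have hF : HasFiniteRenormAction m a c x₀ P φ := by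
    by_contra hF
    exact hfinite (if_neg hF)
  obtain ⟨hU, hL⟩ := hF
  set x := trajectory a c x₀ φ with hx
  have hφc : ∀ v w, 1 ≤ v → v ≤ w → IsCurve m φ v w := fun v w hv hvw ↦
    (hD.1 (w + 1) (by linarith)).mono hv hvw (by linarith)
  have hxc : ∀ v w, 1 ≤ v → v ≤ w → IsCurve m x v w := fun v w hv hvw ↦
    (hφc v w hv hvw).trajectory ha hc hx₀ hv hvw
  have hLIcc : ∀ R, 1 ≤ R → IntegrableOn (lagrangian m x) (Icc 1 R) := fun R hR ↦ by
    rw [hx, ← integrableOn_renormLagrangian_iff a c x₀ hP.continuousOn hR (hφc 1 R le_rfl hR),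
      integrableOn_Icc_iff_integrableOn_Ioc]
    exact hL.mono_set Ioc_subset_Ioi_self
  have hxfin : ∀ R, 1 ≤ R → lagrangianAction m x 1 R ≠ ∞ := fun R hR ↦ by
    refine lagrangianAction_ne_top hm ?_ (hLIcc R hR)
    rw [Measure.restrict_congr_set Ioc_ae_eq_Icc.symm]
    exact ae_restrict_of_ae_restrict_of_subset Ioc_subset_Ioi_self hU
  have hxfin' : ∀ v w, 1 ≤ v → v ≤ w → lagrangianAction m x v w ≠ ∞ := fun v w hv hvw ↦ by
    have := hxfin w (hv.trans hvw)
    rw [lagrangianAction_union x hv hvw] at this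
    exact (ENNReal.add_ne_top.1 this).2
  intro s u hsu hsub
  have hs : 1 ≤ s := hsub (left_mem_Icc.2 hsu.le)
  have hu : 1 ≤ u := hs.trans hsu.le
  refine ⟨hxc s u hs hsu.le, hxfin' s u hs hsu.le, fun s' u' σ hsu' hsub' hσ h1 h2 ↦ ?_⟩
  -- From here on the competitor has finite action, so all actions can be handled as real numbers.
  rcases eq_or_ne (lagrangianAction m σ s' u') ∞ with htop | hσfin
  · rw [htop, top_add]
    exact le_top
  obtain ⟨T, hT⟩ : ∃ T, T = u' - s' - (u - s) := ⟨_, rfl⟩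
  have hsuT : s < u + T := by rw [hT]; linarith
  set R₀ := u + T with hR₀
  have hR₀1 : 1 ≤ R₀ := hs.trans hsuT.le
  set y := splice x σ s s' u T with hy
  have hyc : ∀ R, R₀ ≤ R → IsCurve m y 1 R := fun R hR ↦
    (isCurve_splice hxc hs hsu hsu' hσ h1 h2 hT hR).1
  have hyA : ∀ R, R₀ ≤ R → lagrangianAction m y 1 R = lagrangianAction m x 1 s +
      lagrangianAction m σ s' u' + lagrangianAction m x u (R - T) := fun R hR ↦
    (isCurve_splice hxc hs hsu hsu' hσ h1 h2 hT hR).2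
  have hyfin : ∀ R, R₀ ≤ R → lagrangianAction m y 1 R ≠ ∞ := fun R hR ↦ by
    rw [hyA R hR]
    exact ENNReal.add_ne_top.2 ⟨ENNReal.add_ne_top.2 ⟨hxfin s hs, hσfin⟩,
      hxfin' u (R - T) hu (by linarith)⟩
  have hyright : ∀ t, R₀ ≤ t → y t = x (t - T) := fun t ht ↦
    splice_eq_right hsuT (by rw [hT]; ring) h2 ht
  set ψ : ℝ → Config N d := fun t ↦ y t - refPath a c t - x₀ with hψ
  have hψy : trajectory a c x₀ ψ = y := by
    funext t
    simp only [trajectory, hψ]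
    abel
  have hψright : ∀ t, R₀ ≤ t → ψ t = φ (t - T) + (refPath a c (t - T) - refPath a c t) :=
    fun t ht ↦ by
      simp only [hψ, hyright t ht, hx, trajectory]
      abel
  have hψc : ∀ R, R₀ ≤ R → IsCurve m ψ 1 R := fun R hR ↦
    ⟨((hyc R hR).1.fun_sub (absolutelyContinuous_refPath a c le_rfl (hR₀1.trans hR))).fun_sub
      contDiffOn_const.absolutelyContinuousOnInterval, fun t ht ↦ (configSpace m).sub_mem
        ((configSpace m).sub_mem ((hyc R hR).2 t ht) (refPath_mem ha hc t)) hx₀⟩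
  have hψ1 : ψ 1 = 0 := by
    have : y 1 = x 1 := (splice_eqOn_left 1 ⟨le_rfl, hs⟩).symm
    simp only [hψ, this, hx, trajectory, hD.2.1]
    abel
  have hRT : 1 ≤ R₀ - T := by rw [hR₀]; linarith
  have hsplit : Ioi (1 : ℝ) = Ioc 1 R₀ ∪ Ioi R₀ := (Ioc_union_Ioi_eq_Ioi hR₀1).symm
  have hylag : ∀ R, R₀ ≤ R → IntegrableOn (lagrangian m y) (Icc 1 R) := fun R hR ↦
    (hyc R hR).integrableOn_lagrangian hm (hR₀1.trans hR) (hyfin R hR)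
  have hψD : IsD012 m ψ := by
    refine ⟨fun R hR ↦ ?_, hψ1, ?_⟩
    · exact (hψc (max R R₀) (le_max_right _ _)).mono le_rfl hR.le (le_max_left _ _)
    have h3 : IntegrableOn (fun t ↦ massNormSq m (deriv ψ t)) (Ioi 1) := by
      rw [hsplit]
      refine IntegrableOn.union ?_ (hD.integrableOn_massNormSq_shift hm hR₀1 hRT hψright)
      -- From ‖ψ'‖² ≤ 2‖y'‖² + 2‖r₀'‖² and ‖y'‖² ≤ 2 (½‖y'‖² + U(y)).
      have h4 : IntegrableOn (fun t ↦ 4 * lagrangian m y t +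
          2 * massNormSq m (refVelocity a c t)) (Icc 1 R₀) :=
        ((hylag R₀ le_rfl).const_mul 4).add (((continuous_massNormSq.comp_continuousOn
          (continuousOn_refVelocity a c)).mono Icc_subset_Ici_self).integrableOn_Icc.const_mul 2)
      refine ((h4.mono_set Ioc_subset_Icc_self).mono'
        (measurable_massNormSq_deriv ψ).aestronglyMeasurable ?_)
      refine (ae_restrict_iff' measurableSet_Ioc).2 ?_
      filter_upwards [(hψc R₀ le_rfl).ae_differentiableAt hR₀1] with t ht hmem
      have h5 := deriv_trajectory a c x₀ (show 0 < t by linarith [hmem.1])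
        (ht (Ioc_subset_Icc_self hmem))
      rw [hψy] at h5
      have h6 : deriv ψ t = deriv y t + (-1 : ℝ) • refVelocity a c t := by
        rw [h5, neg_one_smul]
        abel
      rw [Real.norm_of_nonneg (massNormSq_nonneg hm _), h6]
      refine (massNormSq_add_le hm _ _).trans ?_
      rw [massNormSq_smul, lagrangian]
      have : 0 ≤ (potential m (y t)).toReal := ENNReal.toReal_nonneg
      linarith
    have := h3.2
    rwa [hasFiniteIntegral_iff_ofReal (ae_of_all _ fun t ↦ massNormSq_nonneg hm _)] at this
  have hψL : IntegrableOn (renormLagrangian m a c x₀ P ψ) (Ioi 1) := by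
    rw [hsplit]
    refine IntegrableOn.union ?_ (hD.integrableOn_renormLagrangian_shift hm hP hL hR₀1 hRT hψright)
    refine IntegrableOn.mono_set ?_ Ioc_subset_Icc_self
    rw [integrableOn_renormLagrangian_iff a c x₀ hP.continuousOn hR₀1 (hψc R₀ le_rfl), hψy]
    exact hylag R₀ le_rfl
  have hψF : HasFiniteRenormAction m a c x₀ P ψ := by
    refine ⟨ae_restrict_Ioi_of_Icc (R₀ := R₀) fun R hR ↦ ?_, hψL⟩
    have := (hyc R hR).ae_potential_ne_top (hR₀1.trans hR) (hyfin R hR)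
    rwa [← hψy] at this
  have hle : ∫ t in Ioi (1 : ℝ), renormLagrangian m a c x₀ P φ t ≤
      ∫ t in Ioi (1 : ℝ), renormLagrangian m a c x₀ P ψ t := by
    have := hmin ψ hψD
    rwa [renormAction, renormAction, if_pos ⟨hU, hL⟩, if_pos hψF, EReal.coe_le_coe_iff] at this
  set D := (lagrangianAction m σ s' u').toReal - (lagrangianAction m x s u).toReal with hDdef
  -- The cutoffs differ by the delay, so that both truncated motions end at the same point `x R`.
  -- The limit is still the difference of the full renormalized actions.
  have hdiff : Tendsto (fun R ↦ (∫ t in (1 : ℝ)..(R + T), renormLagrangian m a c x₀ P ψ t) -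
      ∫ t in (1 : ℝ)..R, renormLagrangian m a c x₀ P φ t) atTop
      (𝓝 ((∫ t in Ioi (1 : ℝ), renormLagrangian m a c x₀ P ψ t) -
        ∫ t in Ioi (1 : ℝ), renormLagrangian m a c x₀ P φ t)) :=
    (intervalIntegral_tendsto_integral_Ioi 1 hψL
      (tendsto_atTop_add_const_right _ T tendsto_id)).sub
      (intervalIntegral_tendsto_integral_Ioi 1 hL tendsto_id)
  have hlim := tendsto_renormAction_difference (a := a) (c := c) hm hP hD T D
  have heq : ∀ᶠ R in atTop, (∫ t in (1 : ℝ)..(R + T), renormLagrangian m a c x₀ P ψ t) -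
      (∫ t in (1 : ℝ)..R, renormLagrangian m a c x₀ P φ t) =
      D - (∫ t in R..(R + T), (massNormSq m (refVelocity a c t) / 2 + P t)) -
      massInner m (refVelocity a c (R + T)) (φ R + (refPath a c R - refPath a c (R + T))) +
      massInner m (refVelocity a c R) (φ R) := by
    filter_upwards [eventually_ge_atTop u] with R hR
    have hR1 : 1 ≤ R := hu.trans hR
    have hRT' : R₀ ≤ R + T := by rw [hR₀]; linarith
    -- The pieces on `[1, s]` and from `u` on are common to both motions; only `σ` and `x` on `[s,
    -- u]` differ.
    have h3 : ∫ t in (1 : ℝ)..(R + T), lagrangian m y t =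
        D + ∫ t in (1 : ℝ)..R, lagrangian m x t := by
      rw [(hyc _ hRT').integral_lagrangian hm (hR₀1.trans hRT') (hyfin _ hRT'), hyA _ hRT',
        (hxc 1 R le_rfl hR1).integral_lagrangian hm hR1 (hxfin R hR1),
        lagrangianAction_union x hu hR, lagrangianAction_union x hs hsu.le, add_sub_cancel_right,
        ENNReal.toReal_add (ENNReal.add_ne_top.2 ⟨hxfin s hs, hσfin⟩) (hxfin' u R hu hR),
        ENNReal.toReal_add (hxfin s hs) hσfin,
        ENNReal.toReal_add (ENNReal.add_ne_top.2 ⟨hxfin s hs, hxfin' s u hs hsu.le⟩)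
          (hxfin' u R hu hR), ENNReal.toReal_add (hxfin s hs) (hxfin' s u hs hsu.le), hDdef]
      ring
    have h4 := intervalIntegral.integral_add_adjacent_intervals
      (intervalIntegrable_referenceTerm (m := m) a c hP.continuousOn le_rfl hR1)
      (intervalIntegrable_referenceTerm (m := m) a c hP.continuousOn hR1 (hR₀1.trans hRT'))
    rw [integral_renormLagrangian a c x₀ hP.continuousOn (hR₀1.trans hRT') (hψc _ hRT') hψ1
      (hψy ▸ hylag _ hRT'), integral_renormLagrangian a c x₀ hP.continuousOn hR1
      (hφc 1 R le_rfl hR1) hD.2.1 (hLIcc R hR1), hψy, h3, ← h4, boundaryTerm, boundaryTerm,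
      hψright _ hRT', add_sub_cancel_right]
    ring
  have hnonneg : 0 ≤ D + T * (massNormSq m a / 2) := by
    rw [← tendsto_nhds_unique (hdiff.congr' heq) hlim]
    linarith
  rw [← hh] at hnonneg
  have e1 : 0 ≤ (h : ℝ) * (u - s) := mul_nonneg h.coe_nonneg (by linarith)
  have e2 : 0 ≤ (h : ℝ) * (u' - s') := mul_nonneg h.coe_nonneg (by linarith)
  rw [← ENNReal.ofReal_toReal (hxfin' s u hs hsu.le), ← ENNReal.ofReal_toReal hσfin,
    ← ENNReal.ofReal_add ENNReal.toReal_nonneg e1, ← ENNReal.ofReal_add ENNReal.toReal_nonneg e2]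
  refine ENNReal.ofReal_le_ofReal ?_
  rw [hDdef, hT] at hnonneg
  linarith

end NBody

/-! ### The main theorem -/

theorem mainTheorem5 {N d : ℕ} (hd : 2 ≤ d) (m : Fin N → ℝ) (hm : ∀ i, 0 < m i)
    (a c x₀ : NBody.Config N d) (hx₀ : x₀ ∈ NBody.configSpace m)
    (hsetting : NBody.HyperbolicSetting m a c ∨ NBody.ParabolicSetting m a c ∨
      NBody.HyperbolicParabolicSetting m a c)
    (P : ℝ → ℝ) (hP : NBody.IsReferencePotential m a c P)
    (φ : ℝ → NBody.Config N d) (hφ : NBody.MinimizesRenormAction m a c x₀ P φ)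
    (x : ℝ → NBody.Config N d) (hx : ∀ t, x t = NBody.refPath a c t + φ t + x₀) :
    ∃ h : ℝ≥0, (h : ℝ) = NBody.massNormSq m a / 2 ∧
      (∀ᵐ t ∂(volume.restrict (Ioi (1 : ℝ))), NBody.potential m (x t) ≠ ∞ ∧
        NBody.massNormSq m (deriv x t) / 2 - (NBody.potential m (x t)).toReal = h) ∧
      NBody.IsFreeTimeMinimizer m h (Ici 1) x ∧
      NBody.IsGeodesicRay m h (NBody.refPath a c 1 + x₀) x := by
  obtain ⟨ha, hc⟩ := NBody.mem_configSpace_of_setting hsetting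
  obtain rfl : x = NBody.trajectory a c x₀ φ := by
    funext t
    rw [hx, NBody.trajectory, add_comm (φ t)]
  have hmin := NBody.isFreeTimeMinimizer_trajectory hm ha hc hx₀
    (NBody.isTame_of_isReferencePotential hm hP) hφ
    (h := ⟨NBody.massNormSq m a / 2, div_nonneg (NBody.massNormSq_nonneg hm a) zero_le_two⟩) rfl
  refine ⟨_, rfl, hmin.ae_energy_eq hm, hmin, ?_, fun s t hs hst ↦
    hmin.isMinimizingGeodesic hm hs hst⟩
  rw [NBody.trajectory, hφ.1.2.1, zero_add]
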